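/- Let $N\ge 0$, $\omega>0$, $0<\kappa_1<\dots<\kappa_N<1/2$ and $c_1(0),\dots,c_N(0)>0$. For $t\in\mathbb R$ and $\xi>0$ put $$c_n(t)=c_n(0)\exp\Big(\frac{4\omega\kappa_n}{1-4\kappa_n^2}\,t\Big),\qquad A_{pn}[\xi,t]=\delta_{pn}+\frac{c_n(t)\,\xi^{-2\kappa_n}}{\kappa_p+\kappa_n},$$ $$g(\xi,t)=\ln\int_0^{\xi}\Big(1-\sum_{n,p}\frac{c_n(t)\,s^{-2\kappa_n}}{\kappa_n+1/2}\,A^{-1}_{np}[s,t]\Big)^{-2}ds,\qquad p(\xi,t)=\frac{\omega}{\xi^{2}\,g_\xi(\xi,t)},$$ $$u(x,t)=\frac12\int_0^\infty e^{-|x-g(\xi,t)|}\,p(\xi,t)\,d\xi-\omega,\qquad m=u-u_{xx}.$$ Then all these expressions are well defined ($A$ is invertible, the bracket is positive, the integrals converge), and the following hold. 1. $u$ is the $N$-soliton solution with these data, in the following sense: $u$ is smooth on $\mathbb R\times\mathbb R$ and solves the Camassa–Holm equation $u_t-u_{xxt}+2\omega u_x+3uu_x-2u_xu_{xx}-uu_{xxx}=0$;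 for every $t$ the function $m(\cdot,t)$ is of Schwartz class, $m+\omega>0$, and the spectral problem $\Psi_{xx}=\big(\tfrac14-\tfrac1\omega(k^2+\tfrac14)(m(\cdot,t)+\omega)\big)\Psi$ is reflectionless with discrete data $\kappa_n,c_n(t)$. The last phrase means the following. Let $\varphi(x,k)$, for $\operatorname{Im}k\ge0$, $k\ne0$, be the solution with $\varphi=e^{-ikx}(1+o(1))$ as $x\to-\infty$ and, for real $k\neq 0$, let $\psi(x,k)$ be the solution with $\psi=e^{-ikx}+o(1)$ as $x\to+\infty$. There is a function $a$, continuous on $\{\operatorname{Im}k\ge0\}$ and analytic on $\{\operatorname{Im}k>0\}$, such that $\varphi(x,k)=a(k)\psi(x,k)$ and $|a(k)|=1$ for real $k\ne0$, and $\varphi(x,k)e^{ikx}\to a(k)$ as $x\to+\infty$ for $\operatorname{Im}k>0$; the zeros of $a$ in the upper half plane are exactly the points $i\kappa_n$ and are simple; and $c_n(t)=b_n/(i\,a'(i\kappa_n))$, where the real number $b_n$ (depending on $t$) is given by $\varphi(x,i\kappa_n)=b_ne^{-\kappa_nx}+o(e^{-\kappa_nx})$ as $x\to+\infty$. 2. $g$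 is smooth on $(0,\infty)\times\mathbb R$, and for each $t$ the map $\xi\mapsto g(\xi,t)$ is a bijection of $(0,\infty)$ onto $\mathbb R$ with $g_\xi>0$, hence a diffeomorphism. 3. $\dot g(\xi,t)=u(g(\xi,t),t)$ for all $\xi>0$, $t\in\mathbb R$. Consequently the maps $G_t=g(\cdot,t)\circ g(\cdot,0)^{-1}$ are smooth diffeomorphisms of $\mathbb R$, jointly smooth in $(x,t)$, with $G_0=\mathrm{id}$ and $\partial_tG_t(x)=u(G_t(x),t)$. 4. For every $t$, $m(x,t)=\int_0^\infty\delta(x-g(\xi,t))\,p(\xi,t)\,d\xi-\omega$ as distributions in $x$, i.e. $\int_{\mathbb R}(m(x,t)+\omega)\theta(x)\,dx=\int_0^\infty\theta(g(\xi,t))\,p(\xi,t)\,d\xi$ for all $\theta\in C_c^\infty(\mathbb R)$. -/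

import Mathlib

open Set Filter Topology MeasureTheory

noncomputable section

namespace CamassaHolm

/-! ### The equation -/

/-- Spatial derivative of a function of `(x, t)`. -/
def dx (f : ℝ → ℝ → ℝ) (x t : ℝ) : ℝ := deriv (fun y => f y t) x

/-- Time derivative of a function of `(x, t)`. -/
def dt (f : ℝ → ℝ → ℝ) (x t : ℝ) : ℝ := deriv (fun s => f x s) t

/-- The momentum `m = u - u_xx`. -/
def momentum (u : ℝ → ℝ → ℝ) (x t : ℝ) : ℝ := u x t - dx (dx u) x t

/-- `u` is a smooth solution, on the whole line and for all times, of
`u_t - u_xxt + 2 ω u_x + 3 u u_x - 2 u_x u_xx - u u_xxx = 0`. -/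
def IsSmoothSolution (ω : ℝ) (u : ℝ → ℝ → ℝ) : Prop :=
  ContDiff ℝ (⊤ : ℕ∞) (fun q : ℝ × ℝ => u q.1 q.2) ∧
    ∀ x t : ℝ,
      dt u x t - dt (dx (dx u)) x t + 2 * ω * dx u x t + 3 * u x t * dx u x t
        - 2 * dx u x t * dx (dx u) x t - u x t * dx (dx (dx u)) x t = 0

/-! ### The spectral problem and scattering data -/

/-- `lam(k) = -(k^2 + 1/4) / ω`. -/
def spectralParam (ω : ℝ) (k : ℂ) : ℂ := -(1 / (ω : ℂ)) * (k ^ 2 + 1 / 4)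

/-- `Ψ_xx = (1/4 + lam(k) (m + ω)) Ψ`. -/
def SolvesSpectral (ω : ℝ) (m : ℝ → ℝ) (k : ℂ) (Ψ : ℝ → ℂ) : Prop :=
  ContDiff ℝ 2 Ψ ∧
    ∀ x : ℝ, deriv (deriv Ψ) x = (1 / 4 + spectralParam ω k * ((m x : ℂ) + (ω : ℂ))) * Ψ x

/-- `φ(x, k)`: the solution with `φ = e^{-ikx} (1 + o(1))` as `x → -∞` (for `Im k ≥ 0`). -/
def IsJostLeft (ω : ℝ) (m : ℝ → ℝ) (k : ℂ) (φ : ℝ → ℂ) : Prop :=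
  SolvesSpectral ω m k φ ∧
    Tendsto (fun x : ℝ => φ x * Complex.exp (Complex.I * k * x)) atBot (𝓝 1)

/-- `ψ(x, k)`: the solution with `ψ = e^{-ikx} + o(1)` as `x → +∞` (for real `k ≠ 0`). -/
def IsJostRight (ω : ℝ) (m : ℝ → ℝ) (k : ℝ) (ψ : ℝ → ℂ) : Prop :=
  SolvesSpectral ω m k ψ ∧
    Tendsto (fun x : ℝ => ψ x - Complex.exp (-Complex.I * k * x)) atTop (𝓝 0)

/-- `a`, `b` are the coefficients at real `k ≠ 0` in `φ = a ψ + b ψ̄`. -/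
def IsTransition (ω : ℝ) (m : ℝ → ℝ) (k : ℝ) (a b : ℂ) : Prop :=
  ∃ φ ψ : ℝ → ℂ, IsJostLeft ω m k φ ∧ IsJostRight ω m k ψ ∧
    ∀ x : ℝ, φ x = a * ψ x + b * (starRingEnd ℂ) (ψ x)

/-- The potential `m` is reflectionless (`b(k) = 0`, i.e. `R(k) = b(k)/a(k) = 0`, for all real
`k ≠ 0`), its discrete spectrum in the upper half plane is exactly `{i κ_n}`, consisting of simple
zeros of `a`, and `c_n = b_n / (i a'(i κ_n))`, where
`φ(x, i κ_n) = b_n e^{-κ_n x} + o(e^{-κ_n x})` as `x → +∞`. -/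
def IsReflectionlessWithData {N : ℕ} (ω : ℝ) (m : ℝ → ℝ) (κ c : Fin N → ℝ) : Prop :=
  ∃ (a : ℂ → ℂ) (b : Fin N → ℝ),
    (∀ k : ℝ, k ≠ 0 → IsTransition ω m k (a k) 0 ∧ ‖a k‖ = 1) ∧
    ContinuousOn a {k : ℂ | 0 ≤ k.im} ∧
    DifferentiableOn ℂ a {k : ℂ | 0 < k.im} ∧
    (∀ k : ℂ, 0 < k.im → ∃ φ : ℝ → ℂ, IsJostLeft ω m k φ ∧
      Tendsto (fun x : ℝ => φ x * Complex.exp (Complex.I * k * x)) atTop (𝓝 (a k))) ∧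
    (∀ k : ℂ, 0 < k.im → (a k = 0 ↔ ∃ n, k = Complex.I * (κ n : ℂ))) ∧
    ∀ n, deriv a (Complex.I * (κ n : ℂ)) ≠ 0 ∧
      (c n : ℂ) = (b n : ℂ) / (Complex.I * deriv a (Complex.I * (κ n : ℂ))) ∧
      ∃ φ : ℝ → ℂ, IsJostLeft ω m (Complex.I * (κ n : ℂ)) φ ∧
        Tendsto (fun x : ℝ => φ x * Complex.exp ((κ n : ℂ) * x)) atTop (𝓝 (b n : ℂ))

/-! ### The explicit formulas -/

/-- `c_n(t) = c_n(0) exp(4 ω κ_n t / (1 - 4 κ_n^2))`. -/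
def cEvol {N : ℕ} (ω : ℝ) (κ c₀ : Fin N → ℝ) (t : ℝ) (n : Fin N) : ℝ :=
  c₀ n * Real.exp (4 * ω * κ n / (1 - 4 * κ n ^ 2) * t)

/-- `A_{pn}[ξ,t] = δ_{pn} + c_n(t) ξ^{-2 κ_n} / (κ_p + κ_n)`. -/
def matA {N : ℕ} (ω : ℝ) (κ c₀ : Fin N → ℝ) (ξ t : ℝ) : Matrix (Fin N) (Fin N) ℝ :=
  Matrix.of fun p n =>
    (if p = n then 1 else 0) + cEvol ω κ c₀ t n * ξ ^ (-2 * κ n) / (κ p + κ n)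

/-- `1 - ∑_{n,p} c_n(t) ξ^{-2 κ_n} / (κ_n + 1/2) A⁻¹_{np}[ξ,t]`. -/
def bracket {N : ℕ} (ω : ℝ) (κ c₀ : Fin N → ℝ) (ξ t : ℝ) : ℝ :=
  1 - ∑ n, ∑ p, cEvol ω κ c₀ t n * ξ ^ (-2 * κ n) / (κ n + 1 / 2) * (matA ω κ c₀ ξ t)⁻¹ n p

/-- `g(ξ,t) = ln ∫_0^ξ bracket^{-2}`, for `ξ > 0`. -/
def g {N : ℕ} (ω : ℝ) (κ c₀ : Fin N → ℝ) (ξ t : ℝ) : ℝ :=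
  Real.log (∫ s in (0 : ℝ)..ξ, (bracket ω κ c₀ s t ^ 2)⁻¹)

/-- `p(ξ,t) = ω ξ^{-2} g_ξ^{-1}`, for `ξ > 0`. -/
def p {N : ℕ} (ω : ℝ) (κ c₀ : Fin N → ℝ) (ξ t : ℝ) : ℝ :=
  ω * (ξ ^ 2)⁻¹ * (deriv (fun s => g ω κ c₀ s t) ξ)⁻¹

/-- `u(x,t) = 1/2 ∫_0^∞ exp(-|x - g(ξ,t)|) p(ξ,t) dξ - ω`. -/
def u {N : ℕ} (ω : ℝ) (κ c₀ : Fin N → ℝ) (x t : ℝ) : ℝ :=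
  1 / 2 * (∫ ξ in Ioi (0 : ℝ), Real.exp (-|x - g ω κ c₀ ξ t|) * p ω κ c₀ ξ t) - ω

/-- `μ(x) = ∫_0^∞ δ(x - γ(ξ)) ρ(ξ) dξ` in the sense of distributions on the line. -/
def IsDeltaSuperposition (μ γ ρ : ℝ → ℝ) : Prop :=
  ∀ θ : ℝ → ℝ, ContDiff ℝ (⊤ : ℕ∞) θ → HasCompactSupport θ →
    Integrable (fun x => μ x * θ x) ∧
    IntegrableOn (fun ξ => θ (γ ξ) * ρ ξ) (Ioi 0) ∧
    ∫ x, μ x * θ x = ∫ ξ in Ioi (0 : ℝ), θ (γ ξ) * ρ ξ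

/-- The explicit formulas are meaningful: no inverse, logarithm, quotient or integral in them
is degenerate. -/
def FormulasWellDefined {N : ℕ} (ω : ℝ) (κ c₀ : Fin N → ℝ) : Prop :=
  ∀ t ξ : ℝ, 0 < ξ →
    IsUnit (matA ω κ c₀ ξ t).det ∧ 0 < bracket ω κ c₀ ξ t ∧
    IntervalIntegrable (fun s => (bracket ω κ c₀ s t ^ 2)⁻¹) volume 0 ξ ∧
    0 < ∫ s in (0 : ℝ)..ξ, (bracket ω κ c₀ s t ^ 2)⁻¹

end CamassaHolm

end

/-! Everything is computed in the variable `y = log ξ`. Put `E_n = c_n(t) e^{-2κ_n y}`, let `w`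
solve `A w = 1`, and set `v = E w`. The linear system becomes the symmetric one `(E⁻¹ + C) v = 1`,
with `C` the Cauchy matrix `1/(κ_p + κ_n)`. This `C` is the Gram matrix of the functions `e^{-κ_n
s}` in `L²(0,∞)`, hence positive definite. So such systems are uniquely solvable, with bounds
independent of `E` (`exists_norm_le_of_cauchy_system`). Uniqueness yields the differential
identities, and the uniform bounds yield control of all `y`-derivatives.

Differentiating the system shows that `Φ(l) = 1 - ∑ v_n/(l + κ_n)` makes `e^{-ly} Φ(l)` a solution
of the Schrödinger equation `f'' = (Q + l²) f` (`dx_dx_Phi`). The bracket in the theorem is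
`Φ(1/2)`. The product `P = Φ(1/2) Φ(-1/2)` equals `1 + ∑ β_n v_n w_n`, which is at least 1 (`P_eq`).
The Wronskian of the solutions at `l = ±1/2` then gives `g = y + log (Φ(-1/2)/Φ(1/2))` and `g_y =
1/P`. Thus `x = g` is the Liouville transformation carrying the Schrödinger equation to the spectral
problem with `m + ω = ω P²`.

For the time evolution, pairing the `t`-derivative of the system with `v` gives `Q_t = ω P_y`
(`dt_Q`). The Wronskian also gives `4P²Q = 2PP'' - P'² + 1 - P²` (`four_P_sq_Q`). Differentiating
this in `t` gives an equation for `R = P_t/P` which integrates once to `U = ω(P² - 1) - P R_y` for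
`U = g_t` (`U_eq`). In the variable `x` this says `u - u_xx = ω(P² - 1)`, and Camassa–Holm is the
transport law of `P²` along `g`. The Green function of `1 - ∂²` and the substitution `x = g(ξ,t)`
identify this `u` with the given integral.

The scattering data are read off from `P^{-1/2} e^{-ly} Φ(l)` with `l = ik`. At `+∞` one has `v →
0`; at `-∞`, `v → C⁻¹1`, and interpolation at the points `κ_p` turns the limit of `Φ(l) ∏(l + κ_n)`
into `∏(l - κ_n)`. -/

noncomputable section

namespace CamassaHolm

/-! ### Smooth functions of two real variables -/

/-- Joint smoothness of a function of `(x, t)`. -/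
def Smooth (f : ℝ → ℝ → ℝ) : Prop := ContDiff ℝ (⊤ : ℕ∞) (fun q : ℝ × ℝ => f q.1 q.2)

namespace Smooth

variable {f h : ℝ → ℝ → ℝ}

theorem hasFDerivAt (hf : Smooth f) (x t : ℝ) :
    HasFDerivAt (fun q : ℝ × ℝ => f q.1 q.2) (fderiv ℝ (fun q : ℝ × ℝ => f q.1 q.2) (x, t))
      (x, t) :=
  (hf.differentiable (by simp) (x, t)).hasFDerivAt

theorem hasDerivAt_fst (hf : Smooth f) (x t : ℝ) :
    HasDerivAt (fun y => f y t) (fderiv ℝ (fun q : ℝ × ℝ => f q.1 q.2) (x, t) (1, 0)) x := by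
  have h1 : HasDerivAt (fun y : ℝ => (y, t)) (1, 0) x :=
    (hasDerivAt_id x).prodMk (hasDerivAt_const x t)
  exact (hf.hasFDerivAt x t).comp_hasDerivAt x h1

theorem hasDerivAt_snd (hf : Smooth f) (x t : ℝ) :
    HasDerivAt (fun s => f x s) (fderiv ℝ (fun q : ℝ × ℝ => f q.1 q.2) (x, t) (0, 1)) t := by
  have h1 : HasDerivAt (fun s : ℝ => (x, s)) (0, 1) t :=
    (hasDerivAt_const t x).prodMk (hasDerivAt_id t)
  exact (hf.hasFDerivAt x t).comp_hasDerivAt t h1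

theorem dx_eq (hf : Smooth f) (x t : ℝ) :
    dx f x t = fderiv ℝ (fun q : ℝ × ℝ => f q.1 q.2) (x, t) (1, 0) :=
  (hf.hasDerivAt_fst x t).deriv

theorem dt_eq (hf : Smooth f) (x t : ℝ) :
    dt f x t = fderiv ℝ (fun q : ℝ × ℝ => f q.1 q.2) (x, t) (0, 1) :=
  (hf.hasDerivAt_snd x t).deriv

theorem hasDerivAt_dx (hf : Smooth f) (x t : ℝ) : HasDerivAt (fun y => f y t) (dx f x t) x := by
  rw [hf.dx_eq]; exact hf.hasDerivAt_fst x t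

theorem hasDerivAt_dt (hf : Smooth f) (x t : ℝ) : HasDerivAt (fun s => f x s) (dt f x t) t := by
  rw [hf.dt_eq]; exact hf.hasDerivAt_snd x t

theorem contDiff_fderiv (hf : Smooth f) :
    ContDiff ℝ (⊤ : ℕ∞) (fderiv ℝ (fun q : ℝ × ℝ => f q.1 q.2)) :=
  ContDiff.fderiv_right hf (by simp)

theorem dx (hf : Smooth f) : Smooth (dx f) := by
  have : (fun q : ℝ × ℝ => CamassaHolm.dx f q.1 q.2)
      = fun q => fderiv ℝ (fun q : ℝ × ℝ => f q.1 q.2) q (1, 0) := by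
    funext q; exact hf.dx_eq q.1 q.2
  unfold Smooth
  rw [this]
  exact hf.contDiff_fderiv.clm_apply contDiff_const

theorem dt (hf : Smooth f) : Smooth (dt f) := by
  have : (fun q : ℝ × ℝ => CamassaHolm.dt f q.1 q.2)
      = fun q => fderiv ℝ (fun q : ℝ × ℝ => f q.1 q.2) q (0, 1) := by
    funext q; exact hf.dt_eq q.1 q.2
  unfold Smooth
  rw [this]
  exact hf.contDiff_fderiv.clm_apply contDiff_const

theorem dx_dt (hf : Smooth f) (x t : ℝ) :
    CamassaHolm.dx (CamassaHolm.dt f) x t = CamassaHolm.dt (CamassaHolm.dx f) x t := by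
  obtain ⟨F, hF⟩ : ∃ F : ℝ × ℝ → ℝ, F = fun q : ℝ × ℝ => f q.1 q.2 := ⟨_, rfl⟩
  have hd : HasFDerivAt (fderiv ℝ F) (fderiv ℝ (fderiv ℝ F) (x, t)) (x, t) := by
    rw [hF]
    exact (hf.contDiff_fderiv.differentiable (by simp) (x, t)).hasFDerivAt
  have hap : ∀ v : ℝ × ℝ, HasFDerivAt (fun q => fderiv ℝ F q v)
      ((fderiv ℝ (fderiv ℝ F) (x, t)).flip v) (x, t) := fun v => by
    simpa using hd.clm_apply (hasFDerivAt_const v (x, t))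
  have e1 := (hap (0, 1)).comp_hasDerivAt x ((hasDerivAt_id x).prodMk (hasDerivAt_const x t))
  have e2 := (hap (1, 0)).comp_hasDerivAt t ((hasDerivAt_const t x).prodMk (hasDerivAt_id t))
  have hs : IsSymmSndFDerivAt ℝ F (x, t) := by
    rw [hF]
    exact (ContDiff.contDiffAt hf).isSymmSndFDerivAt (by
      rw [minSmoothness_of_isRCLikeNormedField]; exact WithTop.coe_le_coe.2 (le_top : (2 : ℕ∞) ≤ ⊤))
  have h1 : (fun y => CamassaHolm.dt f y t) = fun y => fderiv ℝ F (y, t) (0, 1) := by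
    rw [hF]; exact funext fun y => hf.dt_eq y t
  have h2 : (fun s => CamassaHolm.dx f x s) = fun s => fderiv ℝ F (x, s) (1, 0) := by
    rw [hF]; exact funext fun s => hf.dx_eq x s
  have hdxdt := (congrArg (fun k => deriv k x) h1).trans e1.deriv
  have hdtdx := (congrArg (fun k => deriv k t) h2).trans e2.deriv
  exact hdxdt.trans ((hs _ _).trans (Eq.symm hdtdx))

/-- The chain rule along a curve. -/
theorem hasDerivAt_comp (hf : Smooth f) {a b : ℝ → ℝ} {a' b' s : ℝ} (ha : HasDerivAt a a' s)
    (hb : HasDerivAt b b' s) :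
    HasDerivAt (fun s => f (a s) (b s))
      (CamassaHolm.dx f (a s) (b s) * a' + CamassaHolm.dt f (a s) (b s) * b') s := by
  have h := (hf.hasFDerivAt (a s) (b s)).comp_hasDerivAt s (ha.prodMk hb)
  convert! h using 1
  rw [hf.dx_eq, hf.dt_eq, show ((a', b') : ℝ × ℝ) = a' • ((1, 0) : ℝ × ℝ) + b' • ((0, 1) : ℝ × ℝ) by
    simp, map_add, map_smul, map_smul]
  simp [mul_comm]

theorem comp (hf : Smooth f) {a b : ℝ → ℝ → ℝ} (ha : Smooth a) (hb : Smooth b) :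
    Smooth (fun x t => f (a x t) (b x t)) :=
  ContDiff.comp (g := fun q : ℝ × ℝ => f q.1 q.2) (f := fun q : ℝ × ℝ => (a q.1 q.2, b q.1 q.2))
    hf (ContDiff.prodMk ha hb)

theorem const (c : ℝ) : Smooth (fun _ _ => c) := contDiff_const
theorem fst : Smooth (fun x _ => x) := contDiff_fst
theorem snd : Smooth (fun _ t => t) := contDiff_snd
theorem add (hf : Smooth f) (hh : Smooth h) : Smooth (fun x t => f x t + h x t) :=
  ContDiff.add hf hh
theorem sub (hf : Smooth f) (hh : Smooth h) : Smooth (fun x t => f x t - h x t) :=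
  ContDiff.sub hf hh
theorem mul (hf : Smooth f) (hh : Smooth h) : Smooth (fun x t => f x t * h x t) :=
  ContDiff.mul hf hh
theorem neg (hf : Smooth f) : Smooth (fun x t => -f x t) := ContDiff.neg hf
theorem inv (hf : Smooth f) (h0 : ∀ x t, f x t ≠ 0) : Smooth (fun x t => (f x t)⁻¹) :=
  ContDiff.inv hf fun q => h0 q.1 q.2
theorem div (hf : Smooth f) (hh : Smooth h) (h0 : ∀ x t, h x t ≠ 0) :
    Smooth (fun x t => f x t / h x t) := ContDiff.div hf hh fun q => h0 q.1 q.2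
theorem log (hf : Smooth f) (h0 : ∀ x t, f x t ≠ 0) : Smooth (fun x t => Real.log (f x t)) :=
  ContDiff.log hf fun q => h0 q.1 q.2
theorem sum {ι : Type*} {s : Finset ι} {f : ι → ℝ → ℝ → ℝ} (hf : ∀ i ∈ s, Smooth (f i)) :
    Smooth (fun x t => ∑ i ∈ s, f i x t) := ContDiff.sum hf
theorem prod {ι : Type*} {s : Finset ι} {f : ι → ℝ → ℝ → ℝ} (hf : ∀ i ∈ s, Smooth (f i)) :
    Smooth (fun x t => ∏ i ∈ s, f i x t) := contDiff_prod hf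

theorem contDiff_left (hf : Smooth f) (t : ℝ) : ContDiff ℝ (⊤ : ℕ∞) (fun x => f x t) :=
  ContDiff.comp (g := fun q : ℝ × ℝ => f q.1 q.2) hf (contDiff_id.prodMk contDiff_const)

theorem continuous_left (hf : Smooth f) (t : ℝ) : Continuous (fun x => f x t) :=
  (hf.contDiff_left t).continuous

end Smooth

/-! ### Derivatives with weighted bounds -/

/-- The first `j` derivatives of `f` exist and are, like `f`, bounded by multiples of `ρ`. -/
def Dec (ρ : ℝ → ℝ) : ℕ → (ℝ → ℝ) → Prop
  | 0, f => ∃ C, ∀ y, |f y| ≤ C * ρ y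
  | j + 1, f => (∃ C, ∀ y, |f y| ≤ C * ρ y) ∧
      ∃ f' : ℝ → ℝ, (∀ y, HasDerivAt f (f' y) y) ∧ Dec ρ j f'

namespace Dec

variable {ρ τ : ℝ → ℝ} {f h : ℝ → ℝ} {j : ℕ}

theorem bound (hf : Dec ρ j f) : ∃ C, ∀ y, |f y| ≤ C * ρ y := by
  cases j with
  | zero => exact hf
  | succ j => exact hf.1

theorem pred : ∀ {j : ℕ} {f : ℝ → ℝ}, Dec ρ (j + 1) f → Dec ρ j f
  | 0, _, hf => hf.1
  | _ + 1, _, ⟨h1, f', h2, h3⟩ => ⟨h1, f', h2, h3.pred⟩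

theorem of_hasDerivAt {f' : ℝ → ℝ} (hf : ∀ y, HasDerivAt f (f' y) y) (h : Dec ρ (j + 1) f) :
    Dec ρ j f' := by
  obtain ⟨-, f'', h2, h3⟩ := h
  have : f' = f'' := funext fun y => (hf y).unique (h2 y)
  rwa [this]

theorem mono (hρ : ∀ y, ρ y ≤ τ y) (h0 : ∀ y, 0 ≤ ρ y) :
    ∀ {j : ℕ} {f : ℝ → ℝ}, Dec ρ j f → Dec τ j f := by
  have key : ∀ f : ℝ → ℝ, (∃ C, ∀ y, |f y| ≤ C * ρ y) → ∃ C, ∀ y, |f y| ≤ C * τ y := by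
    rintro f ⟨C, hC⟩
    refine ⟨|C|, fun y => (hC y).trans ?_⟩
    exact mul_le_mul (le_abs_self C) (hρ y) (h0 y) (abs_nonneg C)
  intro j
  induction j with
  | zero => exact fun {f} hf => key f hf
  | succ j ih => rintro f ⟨h1, f', h2, h3⟩; exact ⟨key f h1, f', h2, ih h3⟩

theorem add : ∀ {j : ℕ} {f h : ℝ → ℝ}, Dec ρ j f → Dec ρ j h → Dec ρ j (fun y => f y + h y) := by
  have key : ∀ f h : ℝ → ℝ, (∃ C, ∀ y, |f y| ≤ C * ρ y) → (∃ C, ∀ y, |h y| ≤ C * ρ y) →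
      ∃ C, ∀ y, |f y + h y| ≤ C * ρ y := by
    rintro f h ⟨C, hC⟩ ⟨D, hD⟩
    refine ⟨C + D, fun y => (abs_add_le _ _).trans ?_⟩
    rw [add_mul]; exact add_le_add (hC y) (hD y)
  intro j
  induction j with
  | zero => exact fun {f h} hf hh => key f h hf hh
  | succ j ih =>
    rintro f h ⟨h1, f', h2, h3⟩ ⟨k1, h', k2, k3⟩
    exact ⟨key f h h1 k1, _, fun y => (h2 y).add (k2 y), ih h3 k3⟩

theorem mul : ∀ {j : ℕ} {f h : ℝ → ℝ}, Dec ρ j f → Dec τ j h →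
    Dec (fun y => ρ y * τ y) j (fun y => f y * h y) := by
  have key : ∀ f h : ℝ → ℝ, (∃ C, ∀ y, |f y| ≤ C * ρ y) → (∃ C, ∀ y, |h y| ≤ C * τ y) →
      ∃ C, ∀ y, |f y * h y| ≤ C * (ρ y * τ y) := by
    rintro f h ⟨C, hC⟩ ⟨D, hD⟩
    refine ⟨C * D, fun y => ?_⟩
    rw [abs_mul]
    calc |f y| * |h y| ≤ (C * ρ y) * (D * τ y) :=
          mul_le_mul (hC y) (hD y) (abs_nonneg _) ((abs_nonneg _).trans (hC y))
      _ = _ := by ring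
  intro j
  induction j with
  | zero => exact fun {f h} hf hh => key f h hf hh
  | succ j ih =>
    rintro f h hf hh
    obtain ⟨h1, f', h2, h3⟩ := id hf
    obtain ⟨k1, h', k2, k3⟩ := id hh
    exact ⟨key f h h1 k1, _, fun y => (h2 y).mul (k2 y), (ih h3 hh.pred).add (ih hf.pred k3)⟩

theorem const (c : ℝ) : ∀ {j : ℕ}, Dec (fun _ => 1) j (fun _ => c)
  | 0 => ⟨|c|, fun _ => by simp⟩
  | _ + 1 => ⟨⟨|c|, fun _ => by simp⟩, fun _ => 0, fun _ => hasDerivAt_const _ _, const 0⟩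

theorem zero : ∀ {j : ℕ}, Dec ρ j (fun _ => 0)
  | 0 => ⟨0, fun _ => by simp⟩
  | _ + 1 => ⟨⟨0, fun _ => by simp⟩, fun _ => 0, fun _ => hasDerivAt_const _ _, zero⟩

theorem const_mul (c : ℝ) (hf : Dec ρ j f) : Dec ρ j (fun y => c * f y) := by
  simpa using (const c).mul hf

theorem neg (hf : Dec ρ j f) : Dec ρ j (fun y => -f y) := by
  simpa using hf.const_mul (-1)

theorem sub (hf : Dec ρ j f) (hh : Dec ρ j h) : Dec ρ j (fun y => f y - h y) := by
  simpa [sub_eq_add_neg] using hf.add hh.neg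

theorem sum {ι : Type*} {s : Finset ι} {f : ι → ℝ → ℝ} (hf : ∀ i ∈ s, Dec ρ j (f i)) :
    Dec ρ j (fun y => ∑ i ∈ s, f i y) := by
  classical
  induction s using Finset.induction_on with
  | empty => simpa using zero
  | insert a s ha ih =>
    simp only [Finset.sum_insert ha]
    exact (hf a (by simp)).add (ih fun i hi => hf i (Finset.mem_insert_of_mem hi))

theorem one_mul (hf : Dec (fun _ => 1) j f) (hh : Dec ρ j h) : Dec ρ j (fun y => f y * h y) := by
  simpa using hf.mul hh

theorem exp (a c : ℝ) : ∀ {j : ℕ},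
    Dec (fun y => Real.exp (a * y)) j (fun y => c * Real.exp (a * y)) := by
  intro j
  have key : ∀ c : ℝ, ∃ C, ∀ y, |c * Real.exp (a * y)| ≤ C * Real.exp (a * y) :=
    fun c => ⟨|c|, fun y => by rw [abs_mul, abs_of_pos (Real.exp_pos _)]⟩
  induction j generalizing c with
  | zero => exact key c
  | succ j ih =>
    refine ⟨key c, fun y => (c * a) * Real.exp (a * y), fun y => ?_, ih _⟩
    have := (((hasDerivAt_id y).const_mul a).exp).const_mul c
    convert! this using 1
    simp; ring

theorem of_or {η : ℝ → ℝ} (hη : ∀ y, ρ y ≤ η y ∨ τ y ≤ η y) (hρ : ∀ y, 0 ≤ ρ y)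
    (hτ : ∀ y, 0 ≤ τ y) : ∀ {j : ℕ} {f : ℝ → ℝ}, Dec ρ j f → Dec τ j f → Dec η j f := by
  have key : ∀ f : ℝ → ℝ, (∃ C, ∀ y, |f y| ≤ C * ρ y) → (∃ C, ∀ y, |f y| ≤ C * τ y) →
      ∃ C, ∀ y, |f y| ≤ C * η y := by
    rintro f ⟨C, hC⟩ ⟨D, hD⟩
    refine ⟨max |C| |D|, fun y => ?_⟩
    rcases hη y with h | h
    · exact (hC y).trans (mul_le_mul ((le_abs_self C).trans (le_max_left _ _)) h (hρ y)
        ((abs_nonneg C).trans (le_max_left _ _)))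
    · exact (hD y).trans (mul_le_mul ((le_abs_self D).trans (le_max_right _ _)) h (hτ y)
        ((abs_nonneg C).trans (le_max_left _ _)))
  intro j
  induction j with
  | zero => exact fun {f} h1 h2 => key f h1 h2
  | succ j ih =>
    rintro f ⟨h1, f', h2, h3⟩ h4
    exact ⟨key f h1 h4.1, f', h2, ih h3 (of_hasDerivAt h2 h4)⟩

theorem abs_iteratedDeriv_le : ∀ {j : ℕ} {f : ℝ → ℝ}, Dec ρ j f →
    ∃ C, ∀ y, |iteratedDeriv j f y| ≤ C * ρ y
  | 0, _, hf => by simpa using hf.bound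
  | _ + 1, f, ⟨_, f', h2, h3⟩ => by
    rw [iteratedDeriv_succ', show deriv f = f' from funext fun y => (h2 y).deriv]
    exact h3.abs_iteratedDeriv_le

/-- Weighted bounds are transported along a flow `Y' = b ∘ Y`. -/
theorem comp_flow {b Y : ℝ → ℝ} (hb : ∀ j, Dec (fun _ => 1) j b)
    (hY : ∀ x, HasDerivAt Y (b (Y x)) x) : ∀ {j : ℕ} {f : ℝ → ℝ}, Dec ρ j f →
    Dec (fun x => ρ (Y x)) j (fun x => f (Y x))
  | 0, _, ⟨C, hC⟩ => ⟨C, fun x => hC (Y x)⟩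
  | j + 1, f, ⟨⟨C, hC⟩, f', h2, h3⟩ =>
    ⟨⟨C, fun x => hC (Y x)⟩, fun x => b (Y x) * f' (Y x),
      fun x => by
        convert! (h2 (Y x)).comp x (hY x) using 1; exact mul_comm _ _,
      comp_flow hb hY ((hb j).one_mul h3)⟩

end Dec

/-! ### The Cauchy matrix `1 / (κ_p + κ_n)` -/

section Cauchy

variable {N : ℕ} {κ : Fin N → ℝ}

/-- Since `∫₀^∞ e^{-(κ_p + κ_n)s} ds = 1/(κ_p + κ_n)`, expanding the square exhibits the Cauchy
matrix as a Gram matrix. -/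
theorem integral_sq_sum_exp (hκ : ∀ n, 0 < κ n) (a : Fin N → ℝ) :
    IntegrableOn (fun s => (∑ n, a n * Real.exp (-κ n * s)) ^ 2) (Ioi 0) ∧
    ∫ s in Ioi (0 : ℝ), (∑ n, a n * Real.exp (-κ n * s)) ^ 2
      = ∑ p, ∑ n, a p * a n / (κ p + κ n) := by
  have hsq : (fun s : ℝ => (∑ n, a n * Real.exp (-κ n * s)) ^ 2)
      = fun s => ∑ p, ∑ n, a p * a n * Real.exp (-(κ p + κ n) * s) := by
    funext s
    rw [sq, Finset.sum_mul_sum]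
    refine Finset.sum_congr rfl fun p _ => Finset.sum_congr rfl fun n _ => ?_
    rw [show -(κ p + κ n) * s = -κ p * s + -κ n * s by ring, Real.exp_add]; ring
  have hneg : ∀ p n, -(κ p + κ n) < 0 := fun p n => by linarith [hκ p, hκ n]
  have hi : ∀ p n, IntegrableOn (fun s => a p * a n * Real.exp (-(κ p + κ n) * s)) (Ioi 0) :=
    fun p n => (integrableOn_exp_mul_Ioi (hneg p n) 0).const_mul _
  rw [hsq]
  refine ⟨integrable_finsetSum _ fun p _ => integrable_finsetSum _ fun n _ => hi p n, ?_⟩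
  rw [integral_finsetSum _ fun p _ => integrable_finsetSum _ fun n _ => hi p n]
  refine Finset.sum_congr rfl fun p _ => ?_
  rw [integral_finsetSum _ fun n _ => hi p n]
  refine Finset.sum_congr rfl fun n _ => ?_
  rw [integral_const_mul, integral_exp_mul_Ioi (hneg p n)]
  simp [div_eq_mul_inv]
  rw [show -κ n + -κ p = -(κ p + κ n) by ring, inv_neg]
  ring

theorem cauchy_form_nonneg (hκ : ∀ n, 0 < κ n) (a : Fin N → ℝ) :
    0 ≤ ∑ p, ∑ n, a p * a n / (κ p + κ n) := by
  rw [← (integral_sq_sum_exp hκ a).2]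
  exact integral_nonneg fun s => sq_nonneg _

/-- If the form vanished, the exponential sum would be zero almost everywhere, hence everywhere on
the half-line by continuity, and exponentials with distinct exponents are linearly independent. -/
theorem cauchy_form_pos (hκ : ∀ n, 0 < κ n) (hinj : Function.Injective κ) {a : Fin N → ℝ}
    (ha : a ≠ 0) : 0 < ∑ p, ∑ n, a p * a n / (κ p + κ n) := by
  refine lt_of_le_of_ne (cauchy_form_nonneg hκ a) fun h0 => ha ?_
  obtain ⟨hi, he⟩ := integral_sq_sum_exp hκ a
  rw [← h0] at he
  have hae := (integral_eq_zero_iff_of_nonneg (fun s => sq_nonneg _) hi).1 he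
  have heq : EqOn (fun s : ℝ => (∑ n, a n * Real.exp (-κ n * s)) ^ 2) 0 (Ioi 0) :=
    Measure.eqOn_open_of_ae_eq hae isOpen_Ioi
      (Continuous.continuousOn (by fun_prop)) continuousOn_const
  -- The sum is sampled at `s = 1, 2, …`, a Vandermonde system in the nodes `e^{-κ_n}`. The point `s
  -- = 0` is not available in `Ioi 0`, so one factor `e^{-κ_n}` is absorbed into the coefficients.
  have hb : (fun n => a n * Real.exp (-κ n)) = 0 := by
    refine Matrix.eq_zero_of_forall_pow_sum_mul_pow_eq_zero (f := fun n => Real.exp (-κ n)) ?_ ?_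
    · intro m n h
      exact hinj (neg_injective (Real.exp_injective h))
    · intro i
      have h1 : (0 : ℝ) < (i : ℕ) + 1 := by positivity
      have h2 := pow_eq_zero_iff (two_ne_zero) |>.1 (heq h1)
      rw [← h2]
      refine Finset.sum_congr rfl fun n _ => ?_
      rw [← Real.exp_nat_mul, mul_assoc, ← Real.exp_add]
      congr 2; ring
  funext n
  have := congrFun hb n
  simpa [(Real.exp_pos _).ne'] using this

/-- Positivity on the compact unit sphere, extended by homogeneity of degree two. The sphere is
empty when `N = 0`. -/
theorem exists_cauchy_form_ge (hκ : ∀ n, 0 < κ n) (hinj : Function.Injective κ) :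
    ∃ c : ℝ, 0 < c ∧ ∀ a : Fin N → ℝ, c * ‖a‖ ^ 2 ≤ ∑ p, ∑ n, a p * a n / (κ p + κ n) := by
  rcases (Metric.sphere (0 : Fin N → ℝ) 1).eq_empty_or_nonempty with h | h
  · refine ⟨1, one_pos, fun a => ?_⟩
    rcases eq_or_ne a 0 with rfl | ha
    · simp
    · have : ‖a‖⁻¹ • a ∈ Metric.sphere (0 : Fin N → ℝ) 1 := by
        simp [norm_smul, norm_ne_zero_iff.2 ha]
      rw [h] at this; exact this.elim
  · obtain ⟨b, hb, hmin⟩ := (isCompact_sphere (0 : Fin N → ℝ) 1).exists_isMinOn h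
      (f := fun a => ∑ p, ∑ n, a p * a n / (κ p + κ n)) (Continuous.continuousOn (by fun_prop))
    have hb0 : b ≠ 0 := by
      rintro rfl; simp at hb
    refine ⟨_, cauchy_form_pos hκ hinj hb0, fun a => ?_⟩
    rcases eq_or_ne a 0 with rfl | ha
    · simp
    · have hn : 0 < ‖a‖ := norm_pos_iff.2 ha
      have hmem : ‖a‖⁻¹ • a ∈ Metric.sphere (0 : Fin N → ℝ) 1 := by
        simp [norm_smul, hn.ne']
      have h1 : ∑ p, ∑ n, b p * b n / (κ p + κ n)
          ≤ ∑ p, ∑ n, (‖a‖⁻¹ • a) p * (‖a‖⁻¹ • a) n / (κ p + κ n) := hmin hmem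
      have h2 : ∑ p, ∑ n, a p * a n / (κ p + κ n)
          = (∑ p, ∑ n, (‖a‖⁻¹ • a) p * (‖a‖⁻¹ • a) n / (κ p + κ n)) * ‖a‖ ^ 2 := by
        simp only [Finset.sum_mul]
        refine Finset.sum_congr rfl fun p _ => Finset.sum_congr rfl fun n _ => ?_
        simp only [Pi.smul_apply, smul_eq_mul]
        field_simp
      rw [h2]
      exact mul_le_mul_of_nonneg_right h1 (sq_nonneg _)

/-- Solutions of `(E⁻¹ + C) f = h`, with `C` the Cauchy matrix and `E` a positive diagonal matrix,
are bounded by `h`, uniformly in `E`. -/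
theorem exists_norm_le_of_cauchy_system (hκ : ∀ n, 0 < κ n) (hinj : Function.Injective κ) :
    ∃ K : ℝ, 0 ≤ K ∧ ∀ e f h : Fin N → ℝ, (∀ n, 0 ≤ e n) →
      (∀ p, e p * f p + ∑ n, f n / (κ p + κ n) = h p) → ‖f‖ ≤ K * ‖h‖ := by
  obtain ⟨c, hc, hform⟩ := exists_cauchy_form_ge hκ hinj
  -- Pairing the system with `f` and dropping the nonnegative diagonal term gives `c‖f‖² ≤ ∑ f_p h_p
  -- ≤ N‖f‖‖h‖`; the factor `N` comes from the sup norm. Dropping the diagonal makes the bound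
  -- uniform in it.
  refine ⟨N / c, by positivity, fun e f h he hs => ?_⟩
  rcases eq_or_ne f 0 with rfl | hf
  · simp; positivity
  have hn : 0 < ‖f‖ := norm_pos_iff.2 hf
  have h1 : ∑ p, ∑ n, f p * f n / (κ p + κ n) ≤ ∑ p, f p * h p := by
    refine Finset.sum_le_sum fun p _ => ?_
    rw [← hs p, mul_add, Finset.mul_sum]
    have : 0 ≤ f p * (e p * f p) := by nlinarith [mul_nonneg (he p) (mul_self_nonneg (f p))]
    have h3 : ∑ n, f p * f n / (κ p + κ n) = ∑ n, f p * (f n / (κ p + κ n)) :=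
      Finset.sum_congr rfl fun n _ => by ring
    linarith
  have h2 : ∑ p, f p * h p ≤ N * (‖f‖ * ‖h‖) := by
    calc ∑ p, f p * h p ≤ ∑ _p : Fin N, ‖f‖ * ‖h‖ := Finset.sum_le_sum fun p _ => by
          calc f p * h p ≤ ‖f p * h p‖ := Real.le_norm_self _
            _ = ‖f p‖ * ‖h p‖ := norm_mul _ _
            _ ≤ _ := mul_le_mul (norm_le_pi_norm f p) (norm_le_pi_norm h p) (norm_nonneg _)
                (norm_nonneg _)
      _ = _ := by simp
  have h3 := (hform f).trans (h1.trans h2)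
  rw [div_mul_eq_mul_div, le_div_iff₀ hc]
  have : (‖f‖ * c) * ‖f‖ ≤ (N * ‖h‖) * ‖f‖ := by nlinarith
  exact le_of_mul_le_mul_right this hn

theorem cauchy_system_injective (hκ : ∀ n, 0 < κ n) (hinj : Function.Injective κ)
    {e f : Fin N → ℝ} (he : ∀ n, 0 ≤ e n)
    (hs : ∀ p, e p * f p + ∑ n, f n / (κ p + κ n) = 0) : f = 0 := by
  obtain ⟨K, -, hK⟩ := exists_norm_le_of_cauchy_system hκ hinj
  have := hK e f 0 he hs
  simpa using this

end Cauchy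

/-! ### Soliton data -/

/-- Admissible parameters of an `N`-soliton. -/
structure SolitonData (N : ℕ) where
  ω : ℝ
  κ : Fin N → ℝ
  c₀ : Fin N → ℝ
  ω_pos : 0 < ω
  κ_inj : Function.Injective κ
  κ_pos : ∀ n, 0 < κ n
  κ_lt : ∀ n, κ n < 1 / 2
  c₀_pos : ∀ n, 0 < c₀ n

namespace SolitonData

variable {N : ℕ} (d : SolitonData N)

/-- `c_n(t) e^{-2 κ_n y}`. -/
def E (n : Fin N) (y t : ℝ) : ℝ := cEvol d.ω d.κ d.c₀ t n * Real.exp (-2 * d.κ n * y)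

/-- The growth rate of `c_n(t)`. -/
def rate (n : Fin N) : ℝ := 4 * d.ω * d.κ n / (1 - 4 * d.κ n ^ 2)

/-- The solution of `A w = 1`, in the variable `y = log ξ`. -/
def w (n : Fin N) (y t : ℝ) : ℝ := ∑ p, (matA d.ω d.κ d.c₀ (Real.exp y) t)⁻¹ n p

/-- `v_n = c_n e^{-2 κ_n y} w_n`. -/
def v (n : Fin N) (y t : ℝ) : ℝ := d.E n y t * d.w n y t

theorem cEvol_pos (n : Fin N) (t : ℝ) : 0 < cEvol d.ω d.κ d.c₀ t n :=
  mul_pos (d.c₀_pos n) (Real.exp_pos _)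

theorem E_pos (n : Fin N) (y t : ℝ) : 0 < d.E n y t := mul_pos (d.cEvol_pos n t) (Real.exp_pos _)

theorem κ_add_pos (p n : Fin N) : 0 < d.κ p + d.κ n := add_pos (d.κ_pos p) (d.κ_pos n)

theorem smooth_E (n : Fin N) : Smooth (d.E n) := by
  unfold Smooth E cEvol; fun_prop

theorem hasDerivAt_E_y (n : Fin N) (y t : ℝ) :
    HasDerivAt (fun y => d.E n y t) (-2 * d.κ n * d.E n y t) y := by
  have := (((hasDerivAt_id y).const_mul (-2 * d.κ n)).exp).const_mul (cEvol d.ω d.κ d.c₀ t n)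
  convert! this using 1
  simp [E]; ring

theorem hasDerivAt_E_t (n : Fin N) (y t : ℝ) :
    HasDerivAt (fun t => d.E n y t) (d.rate n * d.E n y t) t := by
  have := ((((hasDerivAt_id t).const_mul (d.rate n)).exp).const_mul (d.c₀ n)).mul_const
    (Real.exp (-2 * d.κ n * y))
  convert! this using 1
  simp [E, cEvol, rate]; ring

theorem matA_exp (y t : ℝ) (p n : Fin N) : matA d.ω d.κ d.c₀ (Real.exp y) t p n
    = (if p = n then 1 else 0) + d.E n y t / (d.κ p + d.κ n) := by
  simp only [matA, Matrix.of_apply, E]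
  rw [← Real.exp_mul, mul_comm y]

theorem matA_mulVec (y t : ℝ) (f : Fin N → ℝ) (p : Fin N) :
    (matA d.ω d.κ d.c₀ (Real.exp y) t).mulVec f p
      = f p + ∑ n, d.E n y t * f n / (d.κ p + d.κ n) := by
  simp only [Matrix.mulVec, dotProduct, d.matA_exp, add_mul, ite_mul, one_mul, zero_mul,
    Finset.sum_add_distrib, Finset.sum_ite_eq, Finset.mem_univ, if_true]
  congr 1
  exact Finset.sum_congr rfl fun n _ => by ring

/-- `A` itself is not symmetric, but a kernel vector `f` makes `E f` a solution of the homogeneous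
symmetric system, which has only the zero solution. -/
theorem isUnit_det_matA (y t : ℝ) : IsUnit (matA d.ω d.κ d.c₀ (Real.exp y) t).det := by
  rw [← Matrix.isUnit_iff_isUnit_det, ← Matrix.mulVec_injective_iff_isUnit]
  refine (injective_iff_map_eq_zero (Matrix.mulVecLin (matA d.ω d.κ d.c₀ (Real.exp y) t))).2 ?_
  intro f hf
  have hs : ∀ p, (d.E p y t)⁻¹ * (d.E p y t * f p)
      + ∑ n, d.E n y t * f n / (d.κ p + d.κ n) = 0 := fun p => by
    rw [inv_mul_cancel_left₀ (d.E_pos p y t).ne', ← d.matA_mulVec y t f p]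
    exact congrFun hf p
  have := cauchy_system_injective d.κ_pos d.κ_inj (f := fun n => d.E n y t * f n)
    (fun n => (inv_pos.2 (d.E_pos n y t)).le) hs
  funext n
  have h := congrFun this n
  simpa [(d.E_pos n y t).ne'] using h

theorem w_add_sum (p : Fin N) (y t : ℝ) :
    d.w p y t + ∑ n, d.v n y t / (d.κ p + d.κ n) = 1 := by
  have h : (matA d.ω d.κ d.c₀ (Real.exp y) t).mulVec
      ((matA d.ω d.κ d.c₀ (Real.exp y) t)⁻¹.mulVec 1) = 1 := by
    rw [Matrix.mulVec_mulVec, Matrix.mul_nonsing_inv _ (d.isUnit_det_matA y t), Matrix.one_mulVec]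
  have hw : (fun n => d.w n y t) = (matA d.ω d.κ d.c₀ (Real.exp y) t)⁻¹.mulVec 1 := by
    funext n; simp [w, Matrix.mulVec, dotProduct]
  rw [← hw] at h
  have := congrFun h p
  rwa [d.matA_mulVec] at this

theorem smooth_matrix_det {M : Fin N → Fin N → ℝ → ℝ → ℝ} (hM : ∀ i j, Smooth (M i j)) :
    Smooth (fun y t => (Matrix.of fun i j => M i j y t).det) := by
  simp only [Matrix.det_apply', Matrix.of_apply]
  exact Smooth.sum fun σ _ => (Smooth.const _).mul (Smooth.prod fun i _ => hM _ _)

/-- By Cramer's rule the entries of the inverse are quotients of polynomials in the entries of `A`,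
with nonvanishing denominator. -/
theorem smooth_w (n : Fin N) : Smooth (d.w n) := by
  have hA : ∀ p n, Smooth (fun y t => matA d.ω d.κ d.c₀ (Real.exp y) t p n) := fun p n => by
    simp only [d.matA_exp]
    exact (Smooth.const _).add ((d.smooth_E n).div (Smooth.const _) fun _ _ => (d.κ_add_pos p n).ne')
  have hdet : Smooth (fun y t => (matA d.ω d.κ d.c₀ (Real.exp y) t).det) := smooth_matrix_det hA
  have hadj : ∀ n p, Smooth (fun y t => (matA d.ω d.κ d.c₀ (Real.exp y) t).adjugate n p) := by
    intro n p
    simp only [Matrix.adjugate_apply]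
    refine smooth_matrix_det (M := fun i j y t =>
      ((matA d.ω d.κ d.c₀ (Real.exp y) t).updateRow p (Pi.single n 1)) i j) fun i j => ?_
    simp only [Matrix.updateRow_apply]
    split_ifs
    · exact Smooth.const _
    · exact hA i j
  unfold w
  simp only [Matrix.inv_def, Matrix.smul_apply, smul_eq_mul, Ring.inverse_eq_inv']
  exact Smooth.sum fun p _ => (hdet.inv fun y t => (d.isUnit_det_matA y t).ne_zero).mul (hadj n p)

theorem smooth_v (n : Fin N) : Smooth (d.v n) := (d.smooth_E n).mul (d.smooth_w n)

/-! ### The linear system and its derivatives -/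

theorem inv_E_mul_v (n : Fin N) (y t : ℝ) : (d.E n y t)⁻¹ * d.v n y t = d.w n y t :=
  inv_mul_cancel_left₀ (d.E_pos n y t).ne' _

theorem system_v (p : Fin N) (y t : ℝ) :
    (d.E p y t)⁻¹ * d.v p y t + ∑ n, d.v n y t / (d.κ p + d.κ n) = 1 := by
  rw [d.inv_E_mul_v, d.w_add_sum]

/-- The `y`-derivative of a system `(E⁻¹ + C) f = h`. -/
theorem system_deriv_y {f : Fin N → ℝ → ℝ} {h : ℝ → ℝ} {f' : Fin N → ℝ} {h' y t : ℝ} {p : Fin N}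
    (hf : ∀ n, HasDerivAt (f n) (f' n) y) (hh : HasDerivAt h h' y)
    (hs : ∀ y, (d.E p y t)⁻¹ * f p y + ∑ n, f n y / (d.κ p + d.κ n) = h y) :
    (d.E p y t)⁻¹ * f' p + ∑ n, f' n / (d.κ p + d.κ n)
      = h' - 2 * d.κ p * ((d.E p y t)⁻¹ * f p y) := by
  have hE := (d.E_pos p y t).ne'
  have h1 := (((d.hasDerivAt_E_y p y t).inv hE).mul (hf p)).add
    (HasDerivAt.sum fun n (_ : n ∈ Finset.univ) => (hf n).div_const (d.κ p + d.κ n))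
  have h2 : HasDerivAt h _ y := h1.congr_of_eventuallyEq
    (Eventually.of_forall fun z => by simpa using (hs z).symm)
  have h3 := hh.unique h2
  rw [h3]
  field_simp
  simp only [Pi.inv_apply]
  field_simp
  ring

/-- The `t`-derivative of a system `(E⁻¹ + C) f = h`. -/
theorem system_deriv_t {f : Fin N → ℝ → ℝ} {h : ℝ → ℝ} {f' : Fin N → ℝ} {h' y t : ℝ} {p : Fin N}
    (hf : ∀ n, HasDerivAt (f n) (f' n) t) (hh : HasDerivAt h h' t)
    (hs : ∀ t, (d.E p y t)⁻¹ * f p t + ∑ n, f n t / (d.κ p + d.κ n) = h t) :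
    (d.E p y t)⁻¹ * f' p + ∑ n, f' n / (d.κ p + d.κ n)
      = h' + d.rate p * ((d.E p y t)⁻¹ * f p t) := by
  have hE := (d.E_pos p y t).ne'
  have h1 := (((d.hasDerivAt_E_t p y t).inv hE).mul (hf p)).add
    (HasDerivAt.sum fun n (_ : n ∈ Finset.univ) => (hf n).div_const (d.κ p + d.κ n))
  have h2 : HasDerivAt h _ t := h1.congr_of_eventuallyEq
    (Eventually.of_forall fun z => by simpa using (hs z).symm)
  have h3 := hh.unique h2
  rw [h3]
  field_simp
  simp only [Pi.inv_apply]
  field_simp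
  ring

theorem system_dx_v (p : Fin N) (y t : ℝ) :
    (d.E p y t)⁻¹ * dx (d.v p) y t + ∑ n, dx (d.v n) y t / (d.κ p + d.κ n)
      = -2 * d.κ p * d.w p y t := by
  have := d.system_deriv_y (f := fun n y => d.v n y t) (fun n => (d.smooth_v n).hasDerivAt_dx y t)
    (hasDerivAt_const y 1) (fun y => d.system_v p y t)
  rw [this, d.inv_E_mul_v]; ring

theorem system_dt_v (p : Fin N) (y t : ℝ) :
    (d.E p y t)⁻¹ * dt (d.v p) y t + ∑ n, dt (d.v n) y t / (d.κ p + d.κ n)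
      = d.rate p * d.w p y t := by
  have := d.system_deriv_t (f := fun n t => d.v n y t) (fun n => (d.smooth_v n).hasDerivAt_dt y t)
    (hasDerivAt_const t 1) (fun t => d.system_v p y t)
  rw [this, d.inv_E_mul_v]; ring

theorem w_eq (p : Fin N) (y t : ℝ) :
    d.w p y t = 1 - ∑ n, d.v n y t / (d.κ p + d.κ n) := by
  linarith [d.w_add_sum p y t]

theorem dx_w (p : Fin N) (y t : ℝ) :
    dx (d.w p) y t = -∑ n, dx (d.v n) y t / (d.κ p + d.κ n) := by
  have h := (HasDerivAt.sum fun n (_ : n ∈ Finset.univ) =>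
    ((d.smooth_v n).hasDerivAt_dx y t).div_const (d.κ p + d.κ n)).const_sub 1
  refine HasDerivAt.deriv (h.congr_of_eventuallyEq (Eventually.of_forall fun z => ?_))
  simpa using d.w_eq p z t

/-- The Schrödinger potential. -/
def Q (y t : ℝ) : ℝ := 2 * ∑ n, dx (d.v n) y t

/-- The difference of the two sides solves the homogeneous system, so it vanishes by positive
definiteness of `C`. -/
theorem dx_dx_v (n : Fin N) (y t : ℝ) :
    dx (dx (d.v n)) y t = d.Q y t * d.v n y t - 2 * d.κ n * dx (d.v n) y t := by
  have hsys : ∀ p, (d.E p y t)⁻¹ * dx (dx (d.v p)) y t + ∑ n, dx (dx (d.v n)) y t / (d.κ p + d.κ n)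
      = -2 * d.κ p * dx (d.w p) y t - 2 * d.κ p * ((d.E p y t)⁻¹ * dx (d.v p) y t) := fun p =>
    d.system_deriv_y (f := fun n y => dx (d.v n) y t)
      (fun n => (d.smooth_v n).dx.hasDerivAt_dx y t)
      (((d.smooth_w p).hasDerivAt_dx y t).const_mul (-2 * d.κ p)) (fun y => d.system_dx_v p y t)
  have h0 : (fun n => dx (dx (d.v n)) y t + 2 * d.κ n * dx (d.v n) y t - d.Q y t * d.v n y t) = 0 := by
    refine cauchy_system_injective d.κ_pos d.κ_inj (e := fun p => (d.E p y t)⁻¹)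
      (fun p => (inv_pos.2 (d.E_pos p y t)).le) fun p => ?_
    -- Here `2κ_n/(κ_p + κ_n) = 2 - 2κ_p/(κ_p + κ_n)`: exchanging `κ_n` for `κ_p` across the Cauchy
    -- matrix costs a rank-one term, and that term is `Q`.
    have e1 : ∑ n, (dx (dx (d.v n)) y t + 2 * d.κ n * dx (d.v n) y t - d.Q y t * d.v n y t)
        / (d.κ p + d.κ n) = ∑ n, dx (dx (d.v n)) y t / (d.κ p + d.κ n)
          + (d.Q y t - 2 * d.κ p * ∑ n, dx (d.v n) y t / (d.κ p + d.κ n))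
          - d.Q y t * ∑ n, d.v n y t / (d.κ p + d.κ n) := by
      nth_rewrite 2 [Q]
      simp only [Finset.mul_sum, ← Finset.sum_add_distrib, ← Finset.sum_sub_distrib]
      refine Finset.sum_congr rfl fun n _ => ?_
      have := (d.κ_add_pos p n).ne'
      field_simp
      ring
    have e2 := hsys p
    have e3 := d.system_v p y t
    rw [d.dx_w] at e2
    rw [e1]
    linear_combination e2 - d.Q y t * e3
  have := congrFun h0 n
  simp only [Pi.zero_apply] at this
  linarith

/-! ### The Baker–Akhiezer function -/

/-- `Φ(l) = 1 - ∑ v_n / (l + κ_n)`. -/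
def Phi (l : ℝ) (y t : ℝ) : ℝ := 1 - ∑ n, d.v n y t / (l + d.κ n)

theorem smooth_Phi (l : ℝ) : Smooth (d.Phi l) := by
  unfold Phi
  simp only [div_eq_mul_inv]
  exact (Smooth.const 1).sub (Smooth.sum fun n _ => (d.smooth_v n).mul (Smooth.const _))

theorem smooth_Q : Smooth d.Q :=
  (Smooth.const 2).mul (Smooth.sum fun n _ => (d.smooth_v n).dx)

theorem dx_Phi (l y t : ℝ) : dx (d.Phi l) y t = -∑ n, dx (d.v n) y t / (l + d.κ n) := by
  have h := (HasDerivAt.sum fun n (_ : n ∈ Finset.univ) =>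
    ((d.smooth_v n).hasDerivAt_dx y t).div_const (l + d.κ n)).const_sub 1
  refine HasDerivAt.deriv (h.congr_of_eventuallyEq (Eventually.of_forall fun z => ?_))
  simp [Phi]

theorem dt_Phi (l y t : ℝ) : dt (d.Phi l) y t = -∑ n, dt (d.v n) y t / (l + d.κ n) := by
  have h := (HasDerivAt.sum fun n (_ : n ∈ Finset.univ) =>
    ((d.smooth_v n).hasDerivAt_dt y t).div_const (l + d.κ n)).const_sub 1
  refine HasDerivAt.deriv (h.congr_of_eventuallyEq (Eventually.of_forall fun z => ?_))
  simp [Phi]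

/-- Equivalently, `e^{-ly} Φ(l)` solves `f'' = (Q + l²) f`. It follows termwise from `dx_dx_v` by
writing `κ_n = (l + κ_n) - l`. -/
theorem dx_dx_Phi {l : ℝ} (hl : ∀ n, l + d.κ n ≠ 0) (y t : ℝ) :
    dx (dx (d.Phi l)) y t = 2 * l * dx (d.Phi l) y t + d.Q y t * d.Phi l y t := by
  have h := (HasDerivAt.sum fun n (_ : n ∈ Finset.univ) =>
    ((d.smooth_v n).dx.hasDerivAt_dx y t).div_const (l + d.κ n)).neg
  have h2 : dx (dx (d.Phi l)) y t = -∑ n, dx (dx (d.v n)) y t / (l + d.κ n) :=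
    HasDerivAt.deriv (h.congr_of_eventuallyEq (Eventually.of_forall fun z => by
      simpa using d.dx_Phi l z t))
  have h3 : ∑ n, dx (dx (d.v n)) y t / (l + d.κ n) = d.Q y t * ∑ n, d.v n y t / (l + d.κ n)
      + 2 * l * ∑ n, dx (d.v n) y t / (l + d.κ n) - d.Q y t := by
    nth_rewrite 2 [Q]
    simp only [Finset.mul_sum, ← Finset.sum_add_distrib, ← Finset.sum_sub_distrib]
    refine Finset.sum_congr rfl fun n _ => ?_
    have := hl n
    rw [d.dx_dx_v]
    field_simp
    ring
  rw [h2, h3, d.dx_Phi, Phi]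
  ring

theorem half_add_ne (n : Fin N) : (1 / 2 : ℝ) + d.κ n ≠ 0 := by
  have := d.κ_pos n; positivity

theorem neg_half_add_ne (n : Fin N) : (-(1 / 2) : ℝ) + d.κ n ≠ 0 := by
  have := d.κ_lt n; intro h; linarith

/-- `Φ(1/2)`. -/
def Pp (y t : ℝ) : ℝ := d.Phi (1 / 2) y t
/-- `Φ(-1/2)`. -/
def Pm (y t : ℝ) : ℝ := d.Phi (-(1 / 2)) y t
/-- `Φ(1/2) Φ(-1/2)`, the reciprocal of the Jacobian of the Liouville transformation. -/
def P (y t : ℝ) : ℝ := d.Pp y t * d.Pm y t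

theorem smooth_Pp : Smooth d.Pp := d.smooth_Phi _
theorem smooth_Pm : Smooth d.Pm := d.smooth_Phi _
theorem smooth_P : Smooth d.P := d.smooth_Pp.mul d.smooth_Pm

/-- The coefficients in the partial fraction expansion of `Φ(l) Φ(-l)` at `l = 1/2`. -/
def β (n : Fin N) : ℝ := 2 * d.κ n / (1 / 4 - d.κ n ^ 2)

theorem quarter_sub_sq_pos (n : Fin N) : 0 < 1 / 4 - d.κ n ^ 2 := by
  nlinarith [d.κ_pos n, d.κ_lt n]

theorem β_pos (n : Fin N) : 0 < d.β n :=
  div_pos (mul_pos two_pos (d.κ_pos n)) (d.quarter_sub_sq_pos n)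

theorem rate_eq (n : Fin N) : d.rate n = d.ω / 2 * d.β n := by
  have h := (d.quarter_sub_sq_pos n).ne'
  have h' : 1 - 4 * d.κ n ^ 2 ≠ 0 := fun h' => h (by linarith)
  rw [rate, β]
  field_simp

theorem sum_sum_eq_zero_of_antisymm {F : Fin N → Fin N → ℝ} (hF : ∀ i j, F i j + F j i = 0) :
    ∑ i, ∑ j, F i j = 0 := by
  have h : ∑ i, ∑ j, F i j + ∑ i, ∑ j, F j i = 0 := by
    simp only [← Finset.sum_add_distrib, hF, Finset.sum_const_zero]
  rw [Finset.sum_comm (f := fun i j => F j i)] at h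
  linarith

/-- This is the partial fraction expansion of `Φ(l) Φ(-l)` at `l = 1/2`: the residue at `l = -κ_n`
is `-v_n Φ(κ_n) = -v_n w_n`, and the function is even in `l`. The verification compares double sums
whose difference has an antisymmetric summand. The payoff is positivity, since `v_n w_n = E_n w_n²`.
-/
theorem P_eq (y t : ℝ) : d.P y t = 1 + ∑ n, d.β n * (d.v n y t * d.w n y t) := by
  have key : ∑ i, ∑ j, d.v i y t * d.v j y t * (1 / ((1 / 2 + d.κ i) * (-(1 / 2) + d.κ j))
      + d.β i / (d.κ i + d.κ j)) = 0 := by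
    refine sum_sum_eq_zero_of_antisymm fun i j => ?_
    have hi := d.half_add_ne i
    have hj := d.half_add_ne j
    have hi' := d.neg_half_add_ne i
    have hj' := d.neg_half_add_ne j
    have hij := (d.κ_add_pos i j).ne'
    have hqi : (1 / 4 - d.κ i ^ 2) = -((1 / 2 + d.κ i) * (-(1 / 2) + d.κ i)) := by ring
    have hqj : (1 / 4 - d.κ j ^ 2) = -((1 / 2 + d.κ j) * (-(1 / 2) + d.κ j)) := by ring
    rw [β, β, hqi, hqj, add_comm (d.κ j) (d.κ i)]
    generalize d.κ i = a at *
    generalize d.κ j = b at *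
    have e : 1 / ((1 / 2 + a) * (-(1 / 2) + b)) + 2 * a / (-((1 / 2 + a) * (-(1 / 2) + a))) / (a + b)
      + (1 / ((1 / 2 + b) * (-(1 / 2) + a)) + 2 * b / (-((1 / 2 + b) * (-(1 / 2) + b))) / (a + b))
      = 0 := by
      obtain ⟨A, rfl⟩ : ∃ A, a = A - 1 / 2 := ⟨a + 1 / 2, by ring⟩
      obtain ⟨B, rfl⟩ : ∃ B, b = B - 1 / 2 := ⟨b + 1 / 2, by ring⟩
      have s1 : ∀ A : ℝ, 1 / 2 + (A - 1 / 2) = A := fun A => by ring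
      have s2 : ∀ A : ℝ, -(1 / 2) + (A - 1 / 2) = A - 1 := fun A => by ring
      have s3 : ∀ A : ℝ, 2 * (A - 1 / 2) = 2 * A - 1 := fun A => by ring
      have s4 : A - 1 / 2 + (B - 1 / 2) = A + B - 1 := by ring
      rw [s1] at hi hj
      rw [s2] at hi' hj'
      rw [s4] at hij
      simp only [s1, s2, s3, s4]
      field_simp
      ring
    linear_combination (d.v i y t * d.v j y t) * e
  have hw : ∑ n, d.β n * (d.v n y t * d.w n y t)
      = ∑ n, d.β n * d.v n y t - ∑ i, ∑ j, d.v i y t * d.v j y t * (d.β i / (d.κ i + d.κ j)) := by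
    rw [← Finset.sum_sub_distrib]
    refine Finset.sum_congr rfl fun n _ => ?_
    rw [d.w_eq, mul_sub, mul_sub, mul_one, Finset.mul_sum, Finset.mul_sum]
    congr 1
    exact Finset.sum_congr rfl fun j _ => by ring
  have hlin : ∑ n, d.β n * d.v n y t
      = -(∑ n, d.v n y t / (1 / 2 + d.κ n)) - ∑ n, d.v n y t / (-(1 / 2) + d.κ n) := by
    rw [← Finset.sum_neg_distrib, ← Finset.sum_sub_distrib]
    refine Finset.sum_congr rfl fun n _ => ?_
    have hi := d.half_add_ne n
    have hi' := d.neg_half_add_ne n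
    rw [β, show (1 / 4 - d.κ n ^ 2) = -((1 / 2 + d.κ n) * (-(1 / 2) + d.κ n)) by ring]
    have e : 2 * d.κ n = (1 / 2 + d.κ n) + (-(1 / 2) + d.κ n) := by ring
    rw [e]
    generalize (1 / 2 + d.κ n) = a at *
    generalize (-(1 / 2) + d.κ n) = b at *
    field_simp
    ring
  have hprod : (∑ n, d.v n y t / (1 / 2 + d.κ n)) * ∑ n, d.v n y t / (-(1 / 2) + d.κ n)
      = ∑ i, ∑ j, d.v i y t * d.v j y t * (1 / ((1 / 2 + d.κ i) * (-(1 / 2) + d.κ j))) := by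
    rw [Finset.sum_mul_sum]
    refine Finset.sum_congr rfl fun i _ => Finset.sum_congr rfl fun j _ => ?_
    rw [div_mul_div_comm, div_eq_mul_one_div]
  have hsplit := key
  simp_rw [mul_add (d.v _ y t * d.v _ y t) (1 / _) _, Finset.sum_add_distrib] at hsplit
  rw [hw, hlin, P, Pp, Pm, Phi, Phi]
  linear_combination hsplit + hprod

theorem v_mul_w_nonneg (n : Fin N) (y t : ℝ) : 0 ≤ d.v n y t * d.w n y t := by
  rw [v, mul_assoc]
  exact mul_nonneg (d.E_pos n y t).le (mul_self_nonneg _)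

theorem one_le_P (y t : ℝ) : 1 ≤ d.P y t := by
  rw [d.P_eq]
  have := Finset.sum_nonneg fun n (_ : n ∈ Finset.univ) =>
    mul_nonneg (d.β_pos n).le (d.v_mul_w_nonneg n y t)
  linarith

theorem P_pos (y t : ℝ) : 0 < d.P y t := one_pos.trans_le (d.one_le_P y t)

/-- `E⁻¹ + C` is symmetric, so pairing `(E⁻¹ + C) v_t` with `v` gives `v_t · (E⁻¹ + C) v = ∑ v_t`.
The same pairing, computed from `system_dt_v`, is `∑ rate_n v_n w_n`, and the rates are exactly
`ω/2` times the coefficients in `P_eq`. -/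
theorem sum_dt_v (y t : ℝ) : ∑ n, dt (d.v n) y t = d.ω / 2 * (d.P y t - 1) := by
  have h1 : ∑ p, d.v p y t * ((d.E p y t)⁻¹ * dt (d.v p) y t
      + ∑ n, dt (d.v n) y t / (d.κ p + d.κ n)) = ∑ n, dt (d.v n) y t := by
    have e1 : ∀ p, d.v p y t * ((d.E p y t)⁻¹ * dt (d.v p) y t
        + ∑ n, dt (d.v n) y t / (d.κ p + d.κ n))
        = d.w p y t * dt (d.v p) y t + ∑ n, d.v p y t * dt (d.v n) y t / (d.κ p + d.κ n) := by
      intro p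
      rw [mul_add, Finset.mul_sum, ← d.inv_E_mul_v]
      congr 1
      · ring
      · exact Finset.sum_congr rfl fun n _ => by ring
    simp only [e1, Finset.sum_add_distrib]
    rw [Finset.sum_comm, ← Finset.sum_add_distrib]
    refine Finset.sum_congr rfl fun p _ => ?_
    have e2 : ∑ n, d.v n y t * dt (d.v p) y t / (d.κ n + d.κ p)
        = (∑ n, d.v n y t / (d.κ p + d.κ n)) * dt (d.v p) y t := by
      rw [Finset.sum_mul]
      exact Finset.sum_congr rfl fun n _ => by rw [add_comm (d.κ n)]; ring
    rw [e2, ← add_mul, d.w_add_sum, one_mul]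
  rw [← h1, d.P_eq, add_sub_cancel_left, Finset.mul_sum]
  refine Finset.sum_congr rfl fun p _ => ?_
  rw [d.system_dt_v, d.rate_eq]
  ring

theorem dt_Q (y t : ℝ) : dt d.Q y t = d.ω * dx d.P y t := by
  have h1 : dt d.Q y t = 2 * ∑ n, dt (dx (d.v n)) y t := by
    have := (HasDerivAt.sum fun n (_ : n ∈ Finset.univ) =>
      (d.smooth_v n).dx.hasDerivAt_dt y t).const_mul 2
    exact HasDerivAt.deriv (this.congr_of_eventuallyEq (Eventually.of_forall fun z => by simp [Q]))
  have h2 := (HasDerivAt.sum fun n (_ : n ∈ Finset.univ) => (d.smooth_v n).dt.hasDerivAt_dx y t)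
  have h3 := ((d.smooth_P.hasDerivAt_dx y t).sub_const 1).const_mul (d.ω / 2)
  have h4 := h3.unique (h2.congr_of_eventuallyEq (Eventually.of_forall fun z => by
    simpa using (d.sum_dt_v z t).symm))
  rw [h1]
  have h5 : ∑ n, dt (dx (d.v n)) y t = ∑ n, dx (dt (d.v n)) y t :=
    Finset.sum_congr rfl fun n _ => ((d.smooth_v n).dx_dt y t).symm
  rw [h5]
  linarith

end SolitonData

/-! ### Reciprocals and limits of functions with weighted bounds -/

theorem Dec.inv {f : ℝ → ℝ} {c : ℝ} (hc : 0 < c) (hf : ∀ y, c ≤ f y) :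
    ∀ {j : ℕ}, Dec (fun _ => 1) j f → Dec (fun _ => 1) j (fun y => (f y)⁻¹) := by
  have key : ∃ C, ∀ y, |(f y)⁻¹| ≤ C * 1 := ⟨c⁻¹, fun y => by
    rw [abs_of_pos (inv_pos.2 (hc.trans_le (hf y))), mul_one]
    exact inv_anti₀ hc (hf y)⟩
  intro j
  induction j with
  | zero => exact fun _ => key
  | succ j ih =>
    intro h
    obtain ⟨h1, f', h2, h3⟩ := id h
    refine ⟨key, fun y => -(f' y * ((f y)⁻¹ * (f y)⁻¹)), fun y => ?_,
      (h3.one_mul ((ih h.pred).one_mul (ih h.pred))).neg⟩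
    convert! (h2 y).inv (hc.trans_le (hf y)).ne' using 1
    ring

theorem Dec.tendsto_zero {ρ f : ℝ → ℝ} {j : ℕ} {l : Filter ℝ} (h : Dec ρ j f)
    (hρ : Tendsto ρ l (𝓝 0)) : Tendsto f l (𝓝 0) := by
  obtain ⟨C, hC⟩ := h.bound
  refine squeeze_zero_norm (fun y => hC y) ?_
  simpa using hρ.const_mul C

namespace SolitonData

variable {N : ℕ} (d : SolitonData N)

/-! ### Bounds -/

/-- The bound for the Cauchy system does not depend on `E`, hence is uniform in `y`. The
differentiated system has the same form, which allows induction on the number of derivatives. -/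
theorem dec_of_system (t : ℝ) : ∀ (j : ℕ) (f h : Fin N → ℝ → ℝ),
    (∀ n, ContDiff ℝ (⊤ : ℕ∞) (f n)) →
    (∀ p y, (d.E p y t)⁻¹ * f p y + ∑ n, f n y / (d.κ p + d.κ n) = h p y) →
    (∀ n, Dec (fun _ => 1) j (h n)) → ∀ n, Dec (fun _ => 1) j (f n) := by
  obtain ⟨K, hK0, hK⟩ := exists_norm_le_of_cauchy_system d.κ_pos d.κ_inj
  have base : ∀ f h : Fin N → ℝ → ℝ,
      (∀ p y, (d.E p y t)⁻¹ * f p y + ∑ n, f n y / (d.κ p + d.κ n) = h p y) →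
      (∀ n, ∃ C, ∀ y, |h n y| ≤ C * 1) → ∀ n, ∃ C, ∀ y, |f n y| ≤ C * 1 := by
    intro f h hs hh n
    choose C hC using hh
    refine ⟨K * ∑ n, |C n|, fun y => ?_⟩
    have h1 := hK (fun p => (d.E p y t)⁻¹) (fun p => f p y) (fun p => h p y)
      (fun p => (inv_pos.2 (d.E_pos p y t)).le) (fun p => hs p y)
    have h2 : ‖fun p => h p y‖ ≤ ∑ n, |C n| := by
      refine (pi_norm_le_iff_of_nonneg (Finset.sum_nonneg fun n _ => abs_nonneg _)).2 fun p => ?_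
      have h3 := hC p y
      rw [mul_one] at h3
      exact (h3.trans (le_abs_self _)).trans
        (Finset.single_le_sum (f := fun n => |C n|) (fun n _ => abs_nonneg _) (Finset.mem_univ p))
    have h4 := norm_le_pi_norm (fun p => f p y) n
    rw [mul_one]
    exact h4.trans (h1.trans (mul_le_mul_of_nonneg_left h2 hK0))
  intro j
  induction j with
  | zero => exact fun f h _ hs hh => base f h hs hh
  | succ j ih =>
    intro f h hf hs hh n
    have hfj := ih f h hf hs fun n => (hh n).pred
    choose h' hh' hd using fun n => (hh n).2
    have hf' : ∀ n y, HasDerivAt (f n) (deriv (f n) y) y := fun n y =>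
      ((hf n).differentiable (by simp) y).hasDerivAt
    refine ⟨(hfj n).bound, deriv (f n), hf' n, ?_⟩
    -- The term `E⁻¹ f_p` produced by differentiation carries a factor that grows at `+∞`; replacing
    -- it by `h_p - ∑ f_n/(κ_p + κ_n)` makes the new right-hand side visibly bounded.
    refine ih (fun n => deriv (f n))
      (fun p y => h' p y - 2 * d.κ p * (h p y - ∑ n, f n y / (d.κ p + d.κ n)))
      (fun n => (contDiff_infty_iff_deriv.1 (hf n)).2) (fun p y => ?_) (fun p => ?_) n
    · rw [d.system_deriv_y (fun n => hf' n y) (hh' p y) (hs p), ← hs p y]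
      ring
    · refine (hd p).sub (((hh p).pred.sub (Dec.sum fun n _ => ?_)).const_mul _)
      simpa only [div_eq_inv_mul] using (hfj n).const_mul (d.κ p + d.κ n)⁻¹

theorem dec_v (n : Fin N) (t : ℝ) (j : ℕ) : Dec (fun _ => 1) j (fun y => d.v n y t) :=
  d.dec_of_system t j (fun n y => d.v n y t) (fun _ _ => 1)
    (fun n => (d.smooth_v n).contDiff_left t) (fun p y => d.system_v p y t)
    (fun _ => Dec.const 1) n

theorem dec_cauchy_sum {ρ : ℝ → ℝ} {j : ℕ} {f : Fin N → ℝ → ℝ} (hf : ∀ n, Dec ρ j (f n)) (l : ℝ) :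
    Dec ρ j (fun y => ∑ n, f n y / (l + d.κ n)) :=
  Dec.sum fun n _ => by
    simpa only [div_eq_inv_mul] using (hf n).const_mul (l + d.κ n)⁻¹

theorem dec_w (n : Fin N) (t : ℝ) (j : ℕ) : Dec (fun _ => 1) j (fun y => d.w n y t) := by
  simp only [d.w_eq]
  exact (Dec.const 1).sub (d.dec_cauchy_sum (fun n => d.dec_v n t j) _)

theorem dec_dt_v (n : Fin N) (t : ℝ) (j : ℕ) : Dec (fun _ => 1) j (fun y => dt (d.v n) y t) :=
  d.dec_of_system t j (fun n y => dt (d.v n) y t) (fun p y => d.rate p * d.w p y t)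
    (fun n => (d.smooth_v n).dt.contDiff_left t) (fun p y => d.system_dt_v p y t)
    (fun p => (d.dec_w p t j).const_mul _) n

theorem exists_decay_rate : ∃ δ : ℝ, 0 < δ ∧ ∀ n, δ ≤ 2 * d.κ n := by
  cases isEmpty_or_nonempty (Fin N)
  · exact ⟨1, one_pos, fun n => isEmptyElim n⟩
  · obtain ⟨m, hm⟩ := Finite.exists_min d.κ
    exact ⟨2 * d.κ m, mul_pos two_pos (d.κ_pos m), fun n => by linarith [hm n]⟩

/-- A common rate of exponential decay. -/
def δ : ℝ := d.exists_decay_rate.choose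

theorem δ_pos : 0 < d.δ := d.exists_decay_rate.choose_spec.1
theorem δ_le (n : Fin N) : d.δ ≤ 2 * d.κ n := d.exists_decay_rate.choose_spec.2 n

/-- A weight that decays at `+∞`. -/
def wplus (y : ℝ) : ℝ := Real.exp (-d.δ * max y 0)

/-- A weight that decays at `±∞`. -/
def wabs (y : ℝ) : ℝ := Real.exp (-d.δ * |y|)

theorem tendsto_wplus : Tendsto d.wplus atTop (𝓝 0) := by
  refine Real.tendsto_exp_atBot.comp ?_
  have h : Tendsto (fun y : ℝ => max y 0) atTop atTop :=
    tendsto_atTop_mono (fun y => le_max_left y 0) tendsto_id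
  exact h.const_mul_atTop_of_neg (neg_lt_zero.2 d.δ_pos)

theorem tendsto_wabs_atTop : Tendsto d.wabs atTop (𝓝 0) :=
  Real.tendsto_exp_atBot.comp (tendsto_abs_atTop_atTop.const_mul_atTop_of_neg
    (neg_lt_zero.2 d.δ_pos))

theorem tendsto_wabs_atBot : Tendsto d.wabs atBot (𝓝 0) :=
  Real.tendsto_exp_atBot.comp (tendsto_abs_atBot_atTop.const_mul_atTop_of_neg
    (neg_lt_zero.2 d.δ_pos))

theorem dec_wplus_of {n : Fin N} {j : ℕ} {f : ℝ → ℝ} (h1 : Dec (fun _ => 1) j f)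
    (h2 : Dec (fun y => Real.exp (-2 * d.κ n * y)) j f) : Dec d.wplus j f := by
  refine Dec.of_or (fun y => ?_) (fun _ => zero_le_one) (fun y => (Real.exp_pos _).le) h1 h2
  rcases le_total y 0 with hy | hy
  · left; simp [wplus, hy]
  · right
    rw [wplus, max_eq_left hy]
    exact Real.exp_le_exp.2 (by nlinarith [d.δ_le n])

theorem dec_E (n : Fin N) (t : ℝ) (j : ℕ) :
    Dec (fun y => Real.exp (-2 * d.κ n * y)) j (fun y => d.E n y t) := Dec.exp _ _

theorem dec_inv_E (n : Fin N) (t : ℝ) (j : ℕ) :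
    Dec (fun y => Real.exp (2 * d.κ n * y)) j (fun y => (d.E n y t)⁻¹) := by
  have : (fun y => (d.E n y t)⁻¹)
      = fun y => (cEvol d.ω d.κ d.c₀ t n)⁻¹ * Real.exp (2 * d.κ n * y) := by
    funext y
    rw [E, mul_inv, ← Real.exp_neg]
    congr 2; ring
  rw [this]
  exact Dec.exp _ _

theorem dec_wplus_v (n : Fin N) (t : ℝ) (j : ℕ) : Dec d.wplus j (fun y => d.v n y t) := by
  refine d.dec_wplus_of (n := n) (d.dec_v n t j) ?_
  simpa [v] using (d.dec_E n t j).mul (d.dec_w n t j)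

theorem dec_wplus_dt_v (n : Fin N) (t : ℝ) (j : ℕ) : Dec d.wplus j (fun y => dt (d.v n) y t) := by
  refine d.dec_wplus_of (n := n) (d.dec_dt_v n t j) ?_
  have h : (fun y => dt (d.v n) y t) = fun y => d.E n y t *
      (d.rate n * d.w n y t - ∑ i, dt (d.v i) y t / (d.κ n + d.κ i)) := by
    funext y
    rw [← d.system_dt_v n y t, add_sub_cancel_right, mul_inv_cancel_left₀ (d.E_pos n y t).ne']
  rw [h]
  simpa using (d.dec_E n t j).mul (((d.dec_w n t j).const_mul (d.rate n)).sub
    (d.dec_cauchy_sum (fun i => d.dec_dt_v i t j) (d.κ n)))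

/-- Two expressions of the same quantity: `v w = E w²` decays at `+∞`, and `v w = E⁻¹ v²` decays at
`-∞`. Neither `v` nor `w` is claimed to decay at both ends. -/
theorem dec_wabs_v_mul_w (n : Fin N) (t : ℝ) (j : ℕ) :
    Dec d.wabs j (fun y => d.v n y t * d.w n y t) := by
  have h1 : Dec (fun y => Real.exp (-2 * d.κ n * y)) j (fun y => d.v n y t * d.w n y t) := by
    simpa [v, mul_assoc] using
      (d.dec_E n t j).mul ((d.dec_w n t j).one_mul (d.dec_w n t j))
  have h2 : Dec (fun y => Real.exp (2 * d.κ n * y)) j (fun y => d.v n y t * d.w n y t) := by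
    have := (d.dec_inv_E n t j).mul ((d.dec_v n t j).one_mul (d.dec_v n t j))
    simp only [mul_one] at this
    convert! this using 2 with y
    rw [← d.inv_E_mul_v n y t]; ring
  refine Dec.of_or (fun y => ?_) (fun _ => (Real.exp_pos _).le) (fun y => (Real.exp_pos _).le) h1 h2
  rcases le_total y 0 with hy | hy
  · right
    rw [wabs, abs_of_nonpos hy]
    exact Real.exp_le_exp.2 (by nlinarith [d.δ_le n])
  · left
    rw [wabs, abs_of_nonneg hy]
    exact Real.exp_le_exp.2 (by nlinarith [d.δ_le n])

theorem dec_wabs_P_sub_one (t : ℝ) (j : ℕ) : Dec d.wabs j (fun y => d.P y t - 1) := by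
  simp only [d.P_eq, add_sub_cancel_left]
  exact Dec.sum fun n _ => (d.dec_wabs_v_mul_w n t j).const_mul _

theorem wabs_le_one (y : ℝ) : d.wabs y ≤ 1 :=
  Real.exp_le_one_iff.2 (by nlinarith [d.δ_pos, abs_nonneg y])

theorem wplus_le_one (y : ℝ) : d.wplus y ≤ 1 :=
  Real.exp_le_one_iff.2 (by nlinarith [d.δ_pos, le_max_right y 0])

theorem dec_P (t : ℝ) (j : ℕ) : Dec (fun _ => 1) j (fun y => d.P y t) := by
  have := (Dec.const 1).add ((d.dec_wabs_P_sub_one t j).mono d.wabs_le_one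
    fun _ => (Real.exp_pos _).le)
  simpa using this

theorem dec_Phi (l t : ℝ) (j : ℕ) : Dec (fun _ => 1) j (fun y => d.Phi l y t) :=
  (Dec.const 1).sub (d.dec_cauchy_sum (fun n => d.dec_v n t j) l)

theorem dec_wplus_Phi_sub_one (l t : ℝ) (j : ℕ) : Dec d.wplus j (fun y => d.Phi l y t - 1) := by
  have := (d.dec_cauchy_sum (fun n => d.dec_wplus_v n t j) l).neg
  convert! this using 2 with y
  rw [Phi]; ring

theorem dec_wplus_dt_Phi (l t : ℝ) (j : ℕ) : Dec d.wplus j (fun y => dt (d.Phi l) y t) := by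
  simp only [d.dt_Phi]
  exact (d.dec_cauchy_sum (fun n => d.dec_wplus_dt_v n t j) l).neg

theorem tendsto_Phi_atTop (l t : ℝ) : Tendsto (fun y => d.Phi l y t) atTop (𝓝 1) := by
  have := ((d.dec_wplus_Phi_sub_one l t 0).tendsto_zero d.tendsto_wplus).add_const 1
  simpa using this

theorem tendsto_dx_Phi_atTop (l t : ℝ) : Tendsto (fun y => dx (d.Phi l) y t) atTop (𝓝 0) := by
  have := Dec.of_hasDerivAt (fun y => ((d.smooth_Phi l).hasDerivAt_dx y t).sub_const 1)
    (d.dec_wplus_Phi_sub_one l t 1)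
  exact this.tendsto_zero d.tendsto_wplus

/-! ### Positivity and the Wronskian -/

/-- `Φ(1/2)` cannot vanish because `P ≥ 1`, and it tends to 1 at `+∞`; the intermediate value
theorem fixes its sign. -/
theorem Pp_pos (y t : ℝ) : 0 < d.Pp y t := by
  by_contra h
  push Not at h
  obtain ⟨z, hz⟩ := ((d.tendsto_Phi_atTop (1 / 2) t).eventually (lt_mem_nhds one_pos)).exists
  obtain ⟨x, hx⟩ := mem_range_of_exists_le_of_exists_ge (d.smooth_Pp.continuous_left t)
    ⟨y, h⟩ ⟨z, hz.le⟩
  have := d.P_pos x t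
  rw [P] at this
  simp only at hx
  rw [hx, zero_mul] at this
  exact lt_irrefl _ this

theorem Pm_pos (y t : ℝ) : 0 < d.Pm y t :=
  pos_of_mul_pos_right (d.P_pos y t) (d.Pp_pos y t).le

theorem dx_dx_Pp (y t : ℝ) : dx (dx d.Pp) y t = dx d.Pp y t + d.Q y t * d.Pp y t := by
  have := d.dx_dx_Phi d.half_add_ne y t
  rw [show (2 : ℝ) * (1 / 2) = 1 by norm_num, one_mul] at this
  exact this

theorem dx_dx_Pm (y t : ℝ) : dx (dx d.Pm) y t = -dx d.Pm y t + d.Q y t * d.Pm y t := by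
  have := d.dx_dx_Phi d.neg_half_add_ne y t
  rw [show (2 : ℝ) * (-(1 / 2)) = -1 by norm_num, neg_one_mul] at this
  exact this

/-- Up to sign conventions this is the Wronskian of the two solutions `e^{∓y/2} Φ(±1/2)` of one
Schrödinger equation. It is constant, and its value is found at `+∞`, where `Φ → 1` and `Φ' → 0`. -/
theorem wronskian (y t : ℝ) :
    d.Pp y t * dx d.Pm y t - dx d.Pp y t * d.Pm y t + d.Pp y t * d.Pm y t = 1 := by
  set W : ℝ → ℝ := fun y =>
    d.Pp y t * dx d.Pm y t - dx d.Pp y t * d.Pm y t + d.Pp y t * d.Pm y t with hW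
  have hd : ∀ y, HasDerivAt W 0 y := fun y => by
    have h1 := d.smooth_Pp.hasDerivAt_dx y t
    have h2 := d.smooth_Pm.hasDerivAt_dx y t
    have h3 := d.smooth_Pp.dx.hasDerivAt_dx y t
    have h4 := d.smooth_Pm.dx.hasDerivAt_dx y t
    convert! ((h1.mul h4).sub (h3.mul h2)).add (h1.mul h2) using 1
    rw [d.dx_dx_Pp, d.dx_dx_Pm]
    ring
  have hc : ∀ z, W z = W y := fun z =>
    is_const_of_deriv_eq_zero (fun z => (hd z).differentiableAt) (fun z => (hd z).deriv) z y
  have hp := d.tendsto_Phi_atTop (1 / 2) t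
  have hm := d.tendsto_Phi_atTop (-(1 / 2)) t
  have hp' := d.tendsto_dx_Phi_atTop (1 / 2) t
  have hm' := d.tendsto_dx_Phi_atTop (-(1 / 2)) t
  have hlim : Tendsto W atTop (𝓝 1) := by
    have := ((hp.mul hm').sub (hp'.mul hm)).add (hp.mul hm)
    simp only [mul_zero, sub_zero, mul_one, zero_add] at this
    exact this
  have hlim' : Tendsto W atTop (𝓝 (W y)) := by
    rw [show W = fun _ => W y from funext hc]; exact tendsto_const_nhds
  exact tendsto_nhds_unique hlim' hlim

/-! ### The Liouville transformation -/

/-- The function `g` in the variable `y = log ξ`. -/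
def gt (y t : ℝ) : ℝ := y + (Real.log (d.Pm y t) - Real.log (d.Pp y t))

theorem smooth_gt : Smooth d.gt :=
  Smooth.fst.add ((d.smooth_Pm.log fun y t => (d.Pm_pos y t).ne').sub
    (d.smooth_Pp.log fun y t => (d.Pp_pos y t).ne'))

/-- The Wronskian identity divided by `P` is the derivative of `y + log (Φ(-1/2)/Φ(1/2))`. -/
theorem dx_gt (y t : ℝ) : dx d.gt y t = (d.P y t)⁻¹ := by
  have hp := (d.Pp_pos y t).ne'
  have hm := (d.Pm_pos y t).ne'
  have h := (hasDerivAt_id y).add (((d.smooth_Pm.hasDerivAt_dx y t).log hm).sub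
    ((d.smooth_Pp.hasDerivAt_dx y t).log hp))
  refine (HasDerivAt.deriv h).trans ?_
  have hw := d.wronskian y t
  rw [P]
  field_simp
  linarith

theorem hasDerivAt_gt (y t : ℝ) : HasDerivAt (fun y => d.gt y t) (d.P y t)⁻¹ y := by
  rw [← d.dx_gt]; exact d.smooth_gt.hasDerivAt_dx y t

/-- The classical nonlinear equation for a product of two solutions of a Schrödinger equation,
normalized by the Wronskian. It recovers the potential from the Jacobian of the Liouville
transformation. -/
theorem four_P_sq_Q (y t : ℝ) : 4 * d.P y t ^ 2 * d.Q y t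
    = 2 * d.P y t * dx (dx d.P) y t - dx d.P y t ^ 2 + 1 - d.P y t ^ 2 := by
  have h1 : ∀ y, HasDerivAt (fun y => d.P y t)
      (dx d.Pp y t * d.Pm y t + d.Pp y t * dx d.Pm y t) y := fun y =>
    (d.smooth_Pp.hasDerivAt_dx y t).mul (d.smooth_Pm.hasDerivAt_dx y t)
  have e1 : ∀ y, dx d.P y t = dx d.Pp y t * d.Pm y t + d.Pp y t * dx d.Pm y t :=
    fun y => (h1 y).deriv
  have e2 : dx (dx d.P) y t = dx (dx d.Pp) y t * d.Pm y t + dx d.Pp y t * dx d.Pm y t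
      + (dx d.Pp y t * dx d.Pm y t + d.Pp y t * dx (dx d.Pm) y t) := by
    refine HasDerivAt.deriv (HasDerivAt.congr_of_eventuallyEq ?_ (Eventually.of_forall e1))
    exact ((d.smooth_Pp.dx.hasDerivAt_dx y t).mul (d.smooth_Pm.hasDerivAt_dx y t)).add
      ((d.smooth_Pp.hasDerivAt_dx y t).mul (d.smooth_Pm.dx.hasDerivAt_dx y t))
  rw [e2, e1, d.dx_dx_Pp, d.dx_dx_Pm, P]
  have hw := d.wronskian y t
  -- With `W` the Wronskian expression, the identity needs `W² = 1`, which is `(W + 1)(W - 1) = 0`.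
  linear_combination (d.Pp y t * dx d.Pm y t - dx d.Pp y t * d.Pm y t
    + d.Pp y t * d.Pm y t + 1) * hw

/-! ### The velocity -/

/-- The velocity `g_t` in the variable `y`. -/
def U : ℝ → ℝ → ℝ := dt d.gt

/-- The logarithmic time derivative of `P`. -/
def R (y t : ℝ) : ℝ := dt d.P y t / d.P y t

theorem smooth_U : Smooth d.U := d.smooth_gt.dt

theorem smooth_R : Smooth d.R := d.smooth_P.dt.div d.smooth_P fun y t => (d.P_pos y t).ne'

theorem dt_P (y t : ℝ) : dt d.P y t = d.R y t * d.P y t :=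
  (div_mul_cancel₀ _ (d.P_pos y t).ne').symm

theorem dx_U (y t : ℝ) : dx d.U y t = -d.R y t / d.P y t := by
  have h0 := (d.P_pos y t).ne'
  have h1 : dx d.U y t = dt (dx d.gt) y t := d.smooth_gt.dx_dt y t
  have h2 : HasDerivAt (fun s => dx d.gt y s) _ t :=
    ((d.smooth_P.hasDerivAt_dt y t).inv h0).congr_of_eventuallyEq
      (Eventually.of_forall fun s => d.dx_gt y s)
  rw [h1]
  refine h2.deriv.trans ?_
  rw [d.dt_P]
  field_simp

/-- The `t`-derivative of `four_P_sq_Q`, with `P_t = R P` and `Q_t = ω P_y`; the terms proportional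
to `R` are reduced by `four_P_sq_Q` itself. The right-hand side is the exact derivative `(P R_y - ω
P²)_y`, and the left-hand side is `-U_y`. -/
theorem R_div_P (y t : ℝ) : d.R y t / d.P y t = d.P y t * dx (dx d.R) y t
    + dx d.P y t * dx d.R y t - 2 * d.ω * d.P y t * dx d.P y t := by
  have h0 := (d.P_pos y t).ne'
  have hR : ∀ y, HasDerivAt (fun y => d.R y t) (dx d.R y t) y := fun y =>
    d.smooth_R.hasDerivAt_dx y t
  have hP : ∀ y, HasDerivAt (fun y => d.P y t) (dx d.P y t) y := fun y =>
    d.smooth_P.hasDerivAt_dx y t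
  have e1 : ∀ y, dt (dx d.P) y t = dx d.R y t * d.P y t + d.R y t * dx d.P y t := fun y => by
    rw [← d.smooth_P.dx_dt]
    exact HasDerivAt.deriv (((hR y).mul (hP y)).congr_of_eventuallyEq
      (Eventually.of_forall fun z => d.dt_P z t))
  have e2 : dt (dx (dx d.P)) y t = dx (dx d.R) y t * d.P y t + dx d.R y t * dx d.P y t
      + (dx d.R y t * dx d.P y t + d.R y t * dx (dx d.P) y t) := by
    rw [← d.smooth_P.dx.dx_dt]
    exact HasDerivAt.deriv ((((d.smooth_R.dx.hasDerivAt_dx y t).mul (hP y)).add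
      ((hR y).mul (d.smooth_P.dx.hasDerivAt_dx y t))).congr_of_eventuallyEq
      (Eventually.of_forall e1))
  have hPt := d.smooth_P.hasDerivAt_dt y t
  have hPxt := d.smooth_P.dx.hasDerivAt_dt y t
  have hPxxt := d.smooth_P.dx.dx.hasDerivAt_dt y t
  have hl := ((hPt.pow 2).const_mul 4).mul (d.smooth_Q.hasDerivAt_dt y t)
  have hr := ((((hPt.const_mul 2).mul hPxxt).sub (hPxt.pow 2)).add_const 1).sub (hPt.pow 2)
  have e3 := hl.unique (hr.congr_of_eventuallyEq (Eventually.of_forall fun s => by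
    simpa using d.four_P_sq_Q y s))
  have e4 := d.four_P_sq_Q y t
  rw [e1, e2, d.dt_P, d.dt_Q] at e3
  simp only [Pi.pow_apply, Nat.cast_ofNat, Nat.add_one_sub_one, pow_one] at e3
  rw [div_eq_iff h0]
  linear_combination (1 / 2) * e3 - d.R y t * e4

/-! ### Lower bounds for `Φ(±1/2)` and decay of the velocity -/

theorem exists_le_Pp (t : ℝ) : ∃ c : ℝ, 0 < c ∧ ∀ y, c ≤ d.Pp y t := by
  obtain ⟨B, hB⟩ := (d.dec_Phi (-(1 / 2)) t 0).bound
  have hm : ∀ y, d.Pm y t ≤ B := fun y => by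
    have := (le_abs_self _).trans (hB y); rwa [mul_one] at this
  have hB0 : 0 < B := (d.Pm_pos 0 t).trans_le (hm 0)
  refine ⟨B⁻¹, inv_pos.2 hB0, fun y => ?_⟩
  have h := d.one_le_P y t
  rw [inv_le_iff_one_le_mul₀ hB0]
  exact h.trans (mul_le_mul_of_nonneg_left (hm y) (d.Pp_pos y t).le)

theorem exists_le_Pm (t : ℝ) : ∃ c : ℝ, 0 < c ∧ ∀ y, c ≤ d.Pm y t := by
  obtain ⟨B, hB⟩ := (d.dec_Phi (1 / 2) t 0).bound
  have hm : ∀ y, d.Pp y t ≤ B := fun y => by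
    have := (le_abs_self _).trans (hB y); rwa [mul_one] at this
  have hB0 : 0 < B := (d.Pp_pos 0 t).trans_le (hm 0)
  refine ⟨B⁻¹, inv_pos.2 hB0, fun y => ?_⟩
  have h := d.one_le_P y t
  rw [inv_le_iff_one_le_mul₀' hB0]
  exact h.trans (mul_le_mul_of_nonneg_right (hm y) (d.Pm_pos y t).le)

theorem dec_inv_Pp (t : ℝ) (j : ℕ) : Dec (fun _ => 1) j (fun y => (d.Pp y t)⁻¹) := by
  obtain ⟨c, hc, h⟩ := d.exists_le_Pp t
  exact Dec.inv hc h (d.dec_Phi _ t j)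

theorem dec_inv_Pm (t : ℝ) (j : ℕ) : Dec (fun _ => 1) j (fun y => (d.Pm y t)⁻¹) := by
  obtain ⟨c, hc, h⟩ := d.exists_le_Pm t
  exact Dec.inv hc h (d.dec_Phi _ t j)

theorem U_eq_log_deriv (y t : ℝ) :
    d.U y t = (d.Pm y t)⁻¹ * dt d.Pm y t - (d.Pp y t)⁻¹ * dt d.Pp y t := by
  have h := (((d.smooth_Pm.hasDerivAt_dt y t).log (d.Pm_pos y t).ne').sub
    ((d.smooth_Pp.hasDerivAt_dt y t).log (d.Pp_pos y t).ne')).const_add y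
  refine (HasDerivAt.deriv h).trans ?_
  rw [div_eq_inv_mul, div_eq_inv_mul]

theorem dec_wplus_U (t : ℝ) (j : ℕ) : Dec d.wplus j (fun y => d.U y t) := by
  simp only [d.U_eq_log_deriv]
  exact ((d.dec_inv_Pm t j).one_mul (d.dec_wplus_dt_Phi _ t j)).sub
    ((d.dec_inv_Pp t j).one_mul (d.dec_wplus_dt_Phi _ t j))

theorem dec_U (t : ℝ) (j : ℕ) : Dec (fun _ => 1) j (fun y => d.U y t) :=
  (d.dec_wplus_U t j).mono d.wplus_le_one fun _ => (Real.exp_pos _).le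

theorem dec_wplus_R (t : ℝ) (j : ℕ) : Dec d.wplus j (fun y => d.R y t) := by
  have h : (fun y => d.R y t) = fun y => (d.P y t)⁻¹ *
      (d.Pm y t * dt d.Pp y t + d.Pp y t * dt d.Pm y t) := by
    funext y
    have : dt d.P y t = d.Pm y t * dt d.Pp y t + d.Pp y t * dt d.Pm y t := by
      refine (HasDerivAt.deriv ((d.smooth_Pp.hasDerivAt_dt y t).mul
        (d.smooth_Pm.hasDerivAt_dt y t))).trans ?_
      ring
    rw [R, this, div_eq_inv_mul]
  rw [h]
  exact (Dec.inv one_pos (fun y => d.one_le_P y t) (d.dec_P t j)).one_mul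
    (((d.dec_Phi _ t j).one_mul (d.dec_wplus_dt_Phi _ t j)).add
      ((d.dec_Phi _ t j).one_mul (d.dec_wplus_dt_Phi _ t j)))

theorem tendsto_P_atTop (t : ℝ) : Tendsto (fun y => d.P y t) atTop (𝓝 1) := by
  have := ((d.dec_wabs_P_sub_one t 0).tendsto_zero d.tendsto_wabs_atTop).add_const 1
  simpa using this

theorem tendsto_P_atBot (t : ℝ) : Tendsto (fun y => d.P y t) atBot (𝓝 1) := by
  have := ((d.dec_wabs_P_sub_one t 0).tendsto_zero d.tendsto_wabs_atBot).add_const 1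
  simpa using this

/-- The relation `u = m + u_xx` in the variable `y`. -/
theorem U_eq (y t : ℝ) : d.U y t = d.ω * (d.P y t ^ 2 - 1) - d.P y t * dx d.R y t := by
  -- `dx_U` and `R_div_P` show that this difference is constant in `y`. It is zero because `U → 0`,
  -- `R_y → 0` and `P → 1` at `+∞`.
  set W : ℝ → ℝ := fun y => d.U y t - (d.ω * (d.P y t ^ 2 - 1) - d.P y t * dx d.R y t) with hW
  have hd : ∀ y, HasDerivAt W 0 y := fun y => by
    have hP := d.smooth_P.hasDerivAt_dx y t
    have h := (d.smooth_U.hasDerivAt_dx y t).sub (((((hP.pow 2).sub_const 1).const_mul d.ω)).sub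
      (hP.mul (d.smooth_R.dx.hasDerivAt_dx y t)))
    convert! h using 1
    have := d.R_div_P y t
    rw [d.dx_U, neg_div, this]
    simp
    ring
  have hc : ∀ z, W z = W y := fun z =>
    is_const_of_deriv_eq_zero (fun z => (hd z).differentiableAt) (fun z => (hd z).deriv) z y
  have hR : Tendsto (fun y => dx d.R y t) atTop (𝓝 0) :=
    (Dec.of_hasDerivAt (fun y => d.smooth_R.hasDerivAt_dx y t)
      (d.dec_wplus_R t 1)).tendsto_zero d.tendsto_wplus
  have hU : Tendsto (fun y => d.U y t) atTop (𝓝 0) :=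
    (d.dec_wplus_U t 0).tendsto_zero d.tendsto_wplus
  have hP := d.tendsto_P_atTop t
  have hlim : Tendsto W atTop (𝓝 0) := by
    have := hU.sub ((((hP.pow 2).sub_const 1).const_mul d.ω).sub (hP.mul hR))
    simpa using this
  have hlim' : Tendsto W atTop (𝓝 (W y)) := by
    rw [show W = fun _ => W y from funext hc]; exact tendsto_const_nhds
  have := tendsto_nhds_unique hlim' hlim
  simp only [hW] at this
  linarith

/-! ### The inverse of the Liouville transformation -/

/-- Both `Φ(1/2)` and `Φ(-1/2)` lie between positive constants, so the logarithm of their ratio is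
bounded. This gives surjectivity, and lets decay in `y` be read as decay in `x`. -/
theorem exists_abs_gt_sub_le (t : ℝ) : ∃ B : ℝ, ∀ y, |d.gt y t - y| ≤ B := by
  obtain ⟨c, hc, hp⟩ := d.exists_le_Pp t
  obtain ⟨c', hc', hm⟩ := d.exists_le_Pm t
  obtain ⟨B, hB⟩ := (d.dec_Phi (1 / 2) t 0).bound
  obtain ⟨B', hB'⟩ := (d.dec_Phi (-(1 / 2)) t 0).bound
  have hp' : ∀ y, d.Pp y t ≤ B := fun y => by
    have := (le_abs_self _).trans (hB y); rwa [mul_one] at this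
  have hm' : ∀ y, d.Pm y t ≤ B' := fun y => by
    have := (le_abs_self _).trans (hB' y); rwa [mul_one] at this
  refine ⟨max (Real.log B' - Real.log c) (Real.log B - Real.log c'), fun y => abs_le.2 ⟨?_, ?_⟩⟩
  · have h1 := Real.log_le_log (d.Pp_pos y t) (hp' y)
    have h2 := Real.log_le_log hc' (hm y)
    have := le_max_right (Real.log B' - Real.log c) (Real.log B - Real.log c')
    rw [gt]; linarith
  · have h1 := Real.log_le_log (d.Pm_pos y t) (hm' y)
    have h2 := Real.log_le_log hc (hp y)
    have := le_max_left (Real.log B' - Real.log c) (Real.log B - Real.log c')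
    rw [gt]; linarith

theorem strictMono_gt (t : ℝ) : StrictMono (fun y => d.gt y t) :=
  strictMono_of_deriv_pos fun y => by
    rw [(d.hasDerivAt_gt y t).deriv]; exact inv_pos.2 (d.P_pos y t)

theorem tendsto_gt_atTop (t : ℝ) : Tendsto (fun y => d.gt y t) atTop atTop := by
  obtain ⟨B, hB⟩ := d.exists_abs_gt_sub_le t
  refine tendsto_atTop_mono (fun y => ?_) (tendsto_atTop_add_const_right atTop (-B) tendsto_id)
  have := (abs_le.1 (hB y)).1
  simp only [id]; linarith

theorem tendsto_gt_atBot (t : ℝ) : Tendsto (fun y => d.gt y t) atBot atBot := by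
  obtain ⟨B, hB⟩ := d.exists_abs_gt_sub_le t
  refine tendsto_atBot_mono (fun y => ?_) (tendsto_atBot_add_const_right atBot B tendsto_id)
  have := (abs_le.1 (hB y)).2
  simp only [id]; linarith

theorem surjective_gt (t : ℝ) : Function.Surjective (fun y => d.gt y t) :=
  (d.smooth_gt.continuous_left t).surjective (d.tendsto_gt_atTop t) (d.tendsto_gt_atBot t)

/-- The inverse of `y ↦ g(e^y, t)`. -/
def Y (x t : ℝ) : ℝ := (d.surjective_gt t x).choose

theorem gt_Y (x t : ℝ) : d.gt (d.Y x t) t = x := (d.surjective_gt t x).choose_spec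

theorem Y_gt (y t : ℝ) : d.Y (d.gt y t) t = y := (d.strictMono_gt t).injective (d.gt_Y _ t)

/-- Inverse function theorem for `(y,t) ↦ (g,t)`, whose derivative is triangular with diagonal
entries `1/P` and 1. Global injectivity identifies the local inverse with `Y`. -/
theorem smooth_Y : Smooth d.Y := by
  refine contDiff_iff_contDiffAt.2 fun ⟨x, t⟩ => ?_
  obtain ⟨y, hy⟩ := d.surjective_gt t x
  simp only at hy
  subst hy
  set F : ℝ × ℝ → ℝ × ℝ := fun q => (d.gt q.1 q.2, q.2) with hF
  have hFs : ContDiff ℝ (⊤ : ℕ∞) F := ContDiff.prodMk d.smooth_gt contDiff_snd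
  have hinj : Function.Injective F := by
    rintro ⟨a, s⟩ ⟨b, r⟩ h
    simp only [hF, Prod.mk.injEq] at h
    obtain ⟨h1, rfl⟩ := h
    rw [(d.strictMono_gt s).injective h1]
  have hP := (d.P_pos y t).ne'
  let e : (ℝ × ℝ) ≃L[ℝ] (ℝ × ℝ) := ContinuousLinearEquiv.equivOfInverse
    (((d.P y t)⁻¹ • ContinuousLinearMap.fst ℝ ℝ ℝ + d.U y t • ContinuousLinearMap.snd ℝ ℝ ℝ).prod
      (ContinuousLinearMap.snd ℝ ℝ ℝ))
    ((d.P y t • (ContinuousLinearMap.fst ℝ ℝ ℝ - d.U y t • ContinuousLinearMap.snd ℝ ℝ ℝ)).prod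
      (ContinuousLinearMap.snd ℝ ℝ ℝ))
    (fun q => by
      ext <;> simp [hP])
    (fun q => by
      ext <;> simp [hP])
  have hderiv : HasFDerivAt F (e : ℝ × ℝ →L[ℝ] ℝ × ℝ) (y, t) := by
    have h1 := (d.smooth_gt.hasFDerivAt y t).prodMk (hasFDerivAt_snd (𝕜 := ℝ) (p := (y, t)))
    convert! h1 using 1
    refine ContinuousLinearMap.ext fun q => ?_
    have h2 : fderiv ℝ (fun q : ℝ × ℝ => d.gt q.1 q.2) (y, t) q
        = (d.P y t)⁻¹ * q.1 + d.U y t * q.2 := by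
      have : q = q.1 • ((1, 0) : ℝ × ℝ) + q.2 • ((0, 1) : ℝ × ℝ) := by ext <;> simp
      rw [this, map_add, map_smul, map_smul, ← d.smooth_gt.dx_eq, ← d.smooth_gt.dt_eq, d.dx_gt]
      simp [U, mul_comm]
    ext
    · simp [e, h2]
    · simp [e]
  have hFat : ContDiffAt ℝ (⊤ : ℕ∞) F (y, t) := hFs.contDiffAt
  have hloc := hFat.to_localInverse hderiv (by simp)
  have hev := (hFat.hasStrictFDerivAt' hderiv (by simp)).eventually_right_inverse
  refine (contDiff_fst.contDiffAt.comp _ hloc).congr_of_eventuallyEq ?_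
  filter_upwards [hev] with q hq
  have : F (d.Y q.1 q.2, q.2) = q := by simp [hF, d.gt_Y]
  have h3 := hinj (this.trans hq.symm)
  exact congrArg Prod.fst h3

theorem hasDerivAt_Y (x t : ℝ) : HasDerivAt (fun x => d.Y x t) (d.P (d.Y x t) t) x := by
  have h1 := d.smooth_Y.hasDerivAt_dx x t
  have h2 := d.smooth_gt.hasDerivAt_comp h1 (hasDerivAt_const x t)
  simp only [d.gt_Y, mul_zero, add_zero, d.dx_gt] at h2
  have h3 := h2.unique (hasDerivAt_id x)
  have h0 := (d.P_pos (d.Y x t) t).ne'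
  rw [inv_mul_eq_iff_eq_mul₀ h0, mul_one] at h3
  rwa [h3] at h1

theorem hasDerivAt_Y_t (x t : ℝ) :
    HasDerivAt (fun t => d.Y x t) (-(d.U (d.Y x t) t * d.P (d.Y x t) t)) t := by
  have h1 := d.smooth_Y.hasDerivAt_dt x t
  have h2 := d.smooth_gt.hasDerivAt_comp h1 (hasDerivAt_id t)
  simp only [d.gt_Y, mul_one, d.dx_gt, id] at h2
  have h3 := h2.unique (hasDerivAt_const t x)
  have h0 := (d.P_pos (d.Y x t) t).ne'
  have h4 : dt d.Y x t = -(d.U (d.Y x t) t * d.P (d.Y x t) t) := by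
    field_simp at h3
    rw [U]; linarith
  rwa [h4] at h1

/-! ### The solution in the variable `x` -/

section Transport

variable {F : ℝ → ℝ → ℝ}

theorem smooth_comp_Y (hF : Smooth F) : Smooth (fun x t => F (d.Y x t) t) :=
  hF.comp d.smooth_Y Smooth.snd

theorem dx_comp_Y (hF : Smooth F) :
    dx (fun x t => F (d.Y x t) t) = fun x t => d.P (d.Y x t) t * dx F (d.Y x t) t := by
  funext x t
  have := hF.hasDerivAt_comp (d.hasDerivAt_Y x t) (hasDerivAt_const x t)
  refine this.deriv.trans ?_
  ring

theorem dt_comp_Y (hF : Smooth F) :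
    dt (fun x t => F (d.Y x t) t) = fun x t => dt F (d.Y x t) t
      - d.U (d.Y x t) t * d.P (d.Y x t) t * dx F (d.Y x t) t := by
  funext x t
  have := hF.hasDerivAt_comp (d.hasDerivAt_Y_t x t) (hasDerivAt_id t)
  refine this.deriv.trans ?_
  simp only [id]
  ring

end Transport

/-- The solution `u`, as the velocity in the variable `x`. -/
def sol (x t : ℝ) : ℝ := d.U (d.Y x t) t

theorem smooth_sol : Smooth d.sol := d.smooth_comp_Y d.smooth_U

theorem dx_sol : dx d.sol = fun x t => -d.R (d.Y x t) t := by
  refine (d.dx_comp_Y d.smooth_U).trans ?_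
  funext x t
  rw [d.dx_U, mul_div_cancel₀ _ (d.P_pos _ _).ne']

theorem dx_dx_sol : dx (dx d.sol) = fun x t => -(d.P (d.Y x t) t * dx d.R (d.Y x t) t) := by
  rw [d.dx_sol]
  refine (d.dx_comp_Y d.smooth_R.neg).trans ?_
  funext x t
  rw [← mul_neg]
  congr 1
  exact ((d.smooth_R.hasDerivAt_dx (d.Y x t) t).neg).deriv

theorem momentum_sol : momentum d.sol = fun x t => d.ω * (d.P (d.Y x t) t ^ 2 - 1) := by
  funext x t
  rw [momentum, d.dx_dx_sol, sol, d.U_eq]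
  ring

/-- Camassa–Holm reads `m_t + u m_x + 2 u_x (m + ω) = 0`. With `m + ω = ω P²` and `u_x = -R`, this
says that `P_t = R P` along the curves `x = g`, which is the definition of `R`. -/
theorem isSmoothSolution_sol : IsSmoothSolution d.ω d.sol := by
  refine ⟨d.smooth_sol, fun x t => ?_⟩
  have hP2 : Smooth (fun y t => d.ω * (d.P y t ^ 2 - 1)) := by
    simp only [sq]
    exact (Smooth.const _).mul ((d.smooth_P.mul d.smooth_P).sub (Smooth.const _))
  have hm_t : dt d.sol x t - dt (dx (dx d.sol)) x t
      = 2 * d.ω * d.P (d.Y x t) t ^ 2 * (d.R (d.Y x t) t - d.sol x t * dx d.P (d.Y x t) t) := by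
    have h1 : HasDerivAt (fun s => momentum d.sol x s) _ t :=
      (d.smooth_sol.hasDerivAt_dt x t).sub (d.smooth_sol.dx.dx.hasDerivAt_dt x t)
    rw [← h1.deriv, d.momentum_sol]
    refine (congrFun (congrFun (d.dt_comp_Y hP2) x) t).trans ?_
    have e1 : dt (fun y t => d.ω * (d.P y t ^ 2 - 1)) (d.Y x t) t
        = d.ω * (2 * d.P (d.Y x t) t * dt d.P (d.Y x t) t) :=
      HasDerivAt.deriv (by
        simpa using (((d.smooth_P.hasDerivAt_dt (d.Y x t) t).pow 2).sub_const 1).const_mul d.ω)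
    have e2 : dx (fun y t => d.ω * (d.P y t ^ 2 - 1)) (d.Y x t) t
        = d.ω * (2 * d.P (d.Y x t) t * dx d.P (d.Y x t) t) :=
      HasDerivAt.deriv (by
        simpa using (((d.smooth_P.hasDerivAt_dx (d.Y x t) t).pow 2).sub_const 1).const_mul d.ω)
    rw [e1, e2, d.dt_P, sol]
    ring
  have hm_x : dx d.sol x t - dx (dx (dx d.sol)) x t
      = 2 * d.ω * d.P (d.Y x t) t ^ 2 * dx d.P (d.Y x t) t := by
    have h1 : HasDerivAt (fun s => momentum d.sol s t) _ x :=
      (d.smooth_sol.hasDerivAt_dx x t).sub (d.smooth_sol.dx.dx.hasDerivAt_dx x t)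
    rw [← h1.deriv, d.momentum_sol]
    refine (congrFun (congrFun (d.dx_comp_Y hP2) x) t).trans ?_
    have e2 : dx (fun y t => d.ω * (d.P y t ^ 2 - 1)) (d.Y x t) t
        = d.ω * (2 * d.P (d.Y x t) t * dx d.P (d.Y x t) t) :=
      HasDerivAt.deriv (by
        simpa using (((d.smooth_P.hasDerivAt_dx (d.Y x t) t).pow 2).sub_const 1).const_mul d.ω)
    rw [e2]
    ring
  have hm : d.sol x t - dx (dx d.sol) x t = d.ω * (d.P (d.Y x t) t ^ 2 - 1) :=
    congrFun (congrFun d.momentum_sol x) t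
  have hux : dx d.sol x t = -d.R (d.Y x t) t := by rw [d.dx_sol]
  linear_combination hm_t + d.sol x t * hm_x + 2 * dx d.sol x t * hm
    + 2 * d.ω * d.P (d.Y x t) t ^ 2 * hux

end SolitonData

/-! ### The Green function of `1 - ∂²` -/

section Green

variable {F F' F'' : ℝ → ℝ} {B : ℝ}

/-- On each side of `x` the integrand has an explicit antiderivative, `e^{z-x}(F - F')` or
`-e^{x-z}(F + F')`. Boundedness suffices, which matters because `m + ω` does not decay. -/
theorem integral_green (h1 : ∀ z, HasDerivAt F (F' z) z) (h2 : ∀ z, HasDerivAt F' (F'' z) z)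
    (hc : Continuous fun z => F z - F'' z) (b0 : ∀ z, |F z| ≤ B) (b1 : ∀ z, |F' z| ≤ B)
    (b2 : ∀ z, |F z - F'' z| ≤ B) (x : ℝ) :
    Integrable (fun z => Real.exp (-|x - z|) * (F z - F'' z)) ∧
      ∫ z, Real.exp (-|x - z|) * (F z - F'' z) = 2 * F x := by
  have eL : ∀ z ∈ Iic x, Real.exp (-|x - z|) * (F z - F'' z)
      = Real.exp (z - x) * (F z - F'' z) := fun z hz => by
    rw [abs_of_nonneg (sub_nonneg.2 hz), neg_sub]
  have eR : ∀ z ∈ Ioi x, Real.exp (-|x - z|) * (F z - F'' z)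
      = Real.exp (x - z) * (F z - F'' z) := fun z hz => by
    rw [abs_of_nonpos (sub_nonpos.2 (le_of_lt hz)), neg_neg]
  have iL : IntegrableOn (fun z => Real.exp (z - x) * (F z - F'' z)) (Iic x) := by
    have hi := (integrableOn_exp_mul_Iic one_pos x).const_mul (B * Real.exp (-x))
    refine hi.mono' (by fun_prop) (Eventually.of_forall fun z => ?_)
    rw [norm_mul, Real.norm_eq_abs, Real.abs_exp, Real.norm_eq_abs]
    calc _ ≤ Real.exp (z - x) * B := mul_le_mul_of_nonneg_left (b2 z) (Real.exp_pos _).le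
      _ = _ := by rw [one_mul, mul_assoc, ← Real.exp_add, mul_comm]; congr 2; ring
  have iR : IntegrableOn (fun z => Real.exp (x - z) * (F z - F'' z)) (Ioi x) := by
    have hi := (integrableOn_exp_mul_Ioi neg_one_lt_zero x).const_mul (B * Real.exp x)
    refine hi.mono' (by fun_prop) (Eventually.of_forall fun z => ?_)
    rw [norm_mul, Real.norm_eq_abs, Real.abs_exp, Real.norm_eq_abs]
    calc _ ≤ Real.exp (x - z) * B := mul_le_mul_of_nonneg_left (b2 z) (Real.exp_pos _).le
      _ = _ := by rw [mul_assoc, ← Real.exp_add, mul_comm]; congr 2; ring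
  have tL : Tendsto (fun z => Real.exp (z - x) * (F z - F' z)) atBot (𝓝 0) := by
    have h0 : Tendsto (fun z => Real.exp (z - x)) atBot (𝓝 0) :=
      Real.tendsto_exp_atBot.comp (tendsto_atBot_add_const_right atBot (-x) tendsto_id)
    refine squeeze_zero_norm (a := fun z => Real.exp (z - x) * (B + B)) (fun z => ?_) (by
      simpa using h0.mul_const (B + B))
    rw [norm_mul, Real.norm_eq_abs, Real.abs_exp, Real.norm_eq_abs]
    exact mul_le_mul_of_nonneg_left ((abs_sub _ _).trans (add_le_add (b0 z) (b1 z)))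
      (Real.exp_pos _).le
  have tR : Tendsto (fun z => -(Real.exp (x - z) * (F z + F' z))) atTop (𝓝 0) := by
    have h0 : Tendsto (fun z => Real.exp (x - z)) atTop (𝓝 0) :=
      Real.tendsto_exp_atBot.comp (tendsto_atBot_add_const_left atTop x tendsto_neg_atTop_atBot)
    refine squeeze_zero_norm (a := fun z => Real.exp (x - z) * (B + B)) (fun z => ?_) (by
      simpa using h0.mul_const (B + B))
    rw [norm_neg, norm_mul, Real.norm_eq_abs, Real.abs_exp, Real.norm_eq_abs]
    exact mul_le_mul_of_nonneg_left ((abs_add_le _ _).trans (add_le_add (b0 z) (b1 z)))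
      (Real.exp_pos _).le
  have vL : ∫ z in Iic x, Real.exp (z - x) * (F z - F'' z) = F x - F' x := by
    rw [integral_Iic_of_hasDerivAt_of_tendsto' (f := fun z => Real.exp (z - x) * (F z - F' z))
      (fun z _ => ?_) iL tL]
    · simp
    · have := (((hasDerivAt_id z).sub_const x).exp).mul ((h1 z).sub (h2 z))
      convert! this using 1
      simp; ring
  have vR : ∫ z in Ioi x, Real.exp (x - z) * (F z - F'' z) = F x + F' x := by
    rw [integral_Ioi_of_hasDerivAt_of_tendsto' (f := fun z => -(Real.exp (x - z) * (F z + F' z)))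
      (fun z _ => ?_) iR tR]
    · simp
    · have := ((((hasDerivAt_id z).const_sub x).exp).mul ((h1 z).add (h2 z))).neg
      convert! this using 1
      simp; ring
  have iL' := iL.congr_fun (fun z hz => (eL z hz).symm) measurableSet_Iic
  have iR' := iR.congr_fun (fun z hz => (eR z hz).symm) measurableSet_Ioi
  constructor
  · rw [← integrableOn_univ, ← Iic_union_Ioi (a := x)]
    exact iL'.union iR'
  · rw [← intervalIntegral.integral_Iic_add_Ioi iL' iR', setIntegral_congr_fun measurableSet_Iic eL,
      setIntegral_congr_fun measurableSet_Ioi eR, vL, vR]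
    ring

end Green

namespace SolitonData

variable {N : ℕ} (d : SolitonData N)

/-! ### The explicit formulas in the variable `y` -/

theorem bracket_exp (y t : ℝ) : bracket d.ω d.κ d.c₀ (Real.exp y) t = d.Pp y t := by
  rw [bracket, Pp, Phi]
  congr 1
  refine Finset.sum_congr rfl fun n _ => ?_
  rw [← Finset.mul_sum, v, w, E, ← Real.exp_mul, mul_comm y, add_comm (d.κ n)]
  ring

theorem bracket_eq {ξ : ℝ} (hξ : 0 < ξ) (t : ℝ) :
    bracket d.ω d.κ d.c₀ ξ t = d.Pp (Real.log ξ) t := by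
  rw [← d.bracket_exp, Real.exp_log hξ]

theorem exp_gt (y t : ℝ) : Real.exp (d.gt y t) = Real.exp y * (d.Pm y t * (d.Pp y t)⁻¹) := by
  rw [gt, Real.exp_add, Real.exp_sub, Real.exp_log (d.Pm_pos y t), Real.exp_log (d.Pp_pos y t),
    div_eq_mul_inv]

theorem hasDerivAt_gt_log {ξ : ℝ} (hξ : 0 < ξ) (t : ℝ) :
    HasDerivAt (fun s => d.gt (Real.log s) t) (ξ⁻¹ * (d.P (Real.log ξ) t)⁻¹) ξ := by
  have := (d.hasDerivAt_gt (Real.log ξ) t).comp ξ (Real.hasDerivAt_log hξ.ne')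
  convert! this using 1
  ring

/-- The integrand has the explicit primitive `e^g = ξ Φ(-1/2)/Φ(1/2)`: its derivative is `e^g / (ξ
P) = Φ(1/2)⁻²`. -/
theorem integral_bracket {ξ : ℝ} (hξ : 0 < ξ) (t : ℝ) :
    IntervalIntegrable (fun s => (bracket d.ω d.κ d.c₀ s t ^ 2)⁻¹) volume 0 ξ ∧
    ∫ s in (0 : ℝ)..ξ, (bracket d.ω d.κ d.c₀ s t ^ 2)⁻¹ = Real.exp (d.gt (Real.log ξ) t) := by
  set H : ℝ → ℝ := fun s => s * (d.Pm (Real.log s) t * (d.Pp (Real.log s) t)⁻¹) with hH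
  have hHpos : ∀ s, 0 < s → H s = Real.exp (d.gt (Real.log s) t) := fun s hs => by
    rw [d.exp_gt, Real.exp_log hs]
  have hderiv : ∀ s, 0 < s → HasDerivAt H ((bracket d.ω d.κ d.c₀ s t ^ 2)⁻¹) s := fun s hs => by
    have h1 := (d.hasDerivAt_gt_log hs t).exp
    have h2 := h1.congr_of_eventuallyEq (f₁ := H)
      ((lt_mem_nhds hs).mono fun r hr => hHpos r hr)
    convert! h2 using 1
    rw [d.bracket_eq hs, d.exp_gt, Real.exp_log hs, P]
    have := (d.Pp_pos (Real.log s) t).ne'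
    have := (d.Pm_pos (Real.log s) t).ne'
    field_simp
  -- At `0` the value of `Real.log` is irrelevant: the factor `s` multiplies a bounded function.
  have hcont0 : ContinuousAt H 0 := by
    obtain ⟨C, hC⟩ := ((d.dec_Phi (-(1 / 2)) t 0).one_mul (d.dec_inv_Pp t 0)).bound
    have hz : H 0 = 0 := by simp [hH]
    rw [ContinuousAt, hz]
    refine squeeze_zero_norm (a := fun s => |s| * C) (fun s => ?_) (by
      have : Tendsto (fun s : ℝ => |s| * C) (𝓝 0) (𝓝 (|0| * C)) :=
        (continuous_abs.mul continuous_const).tendsto 0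
      simpa using this)
    rw [hH, norm_mul, Real.norm_eq_abs, Real.norm_eq_abs]
    have := hC (Real.log s)
    rw [mul_one] at this
    exact mul_le_mul_of_nonneg_left this (abs_nonneg s)
  have hcont : ContinuousOn H (Icc 0 ξ) := fun s hs => by
    rcases hs.1.eq_or_lt with h | h
    · rw [← h]; exact hcont0.continuousWithinAt
    · exact (hderiv s h).continuousAt.continuousWithinAt
  -- Integrability up to `0` needs no estimate: a nonnegative derivative of a function continuous on
  -- the closed interval is integrable.
  have hint : IntervalIntegrable (fun s => (bracket d.ω d.κ d.c₀ s t ^ 2)⁻¹) volume 0 ξ := by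
    refine intervalIntegral.intervalIntegrable_deriv_of_nonneg (g := H) ?_ ?_ ?_
    · rwa [uIcc_of_le hξ.le]
    · intro s hs
      rw [min_eq_left hξ.le] at hs
      exact hderiv s hs.1
    · intro _ _
      positivity
  refine ⟨hint, ?_⟩
  rw [intervalIntegral.integral_eq_sub_of_hasDerivAt_of_le hξ.le hcont
    (fun s hs => hderiv s hs.1) hint, hHpos ξ hξ]
  simp [hH]

theorem g_eq {ξ : ℝ} (hξ : 0 < ξ) (t : ℝ) : g d.ω d.κ d.c₀ ξ t = d.gt (Real.log ξ) t := by
  rw [g, (d.integral_bracket hξ t).2, Real.log_exp]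

theorem hasDerivAt_g {ξ : ℝ} (hξ : 0 < ξ) (t : ℝ) :
    HasDerivAt (fun s => g d.ω d.κ d.c₀ s t) (ξ⁻¹ * (d.P (Real.log ξ) t)⁻¹) ξ :=
  (d.hasDerivAt_gt_log hξ t).congr_of_eventuallyEq
    ((lt_mem_nhds hξ).mono fun _ hs => d.g_eq hs t)

theorem formulasWellDefined : FormulasWellDefined d.ω d.κ d.c₀ := fun t ξ hξ => by
  refine ⟨?_, ?_, (d.integral_bracket hξ t).1, ?_⟩
  · have := d.isUnit_det_matA (Real.log ξ) t
    rwa [Real.exp_log hξ] at this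
  · rw [d.bracket_eq hξ]; exact d.Pp_pos _ _
  · rw [(d.integral_bracket hξ t).2]; exact Real.exp_pos _

theorem bijOn_g (t : ℝ) : BijOn (fun ξ => g d.ω d.κ d.c₀ ξ t) (Ioi 0) univ := by
  refine ⟨fun _ _ => mem_univ _, fun a ha b hb h => ?_, fun x _ => ?_⟩
  · simp only [d.g_eq ha, d.g_eq hb] at h
    exact Real.log_injOn_pos ha hb ((d.strictMono_gt t).injective h)
  · refine ⟨Real.exp (d.Y x t), Real.exp_pos _, ?_⟩
    simp only [d.g_eq (Real.exp_pos _), Real.log_exp, d.gt_Y]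

theorem p_eq {ξ : ℝ} (hξ : 0 < ξ) (t : ℝ) :
    p d.ω d.κ d.c₀ ξ t = (ξ⁻¹ * (d.P (Real.log ξ) t)⁻¹) * (d.ω * d.P (Real.log ξ) t ^ 2) := by
  rw [p, (d.hasDerivAt_g hξ t).deriv]
  have := (d.P_pos (Real.log ξ) t).ne'
  field_simp

/-- The momentum density `m + ω`. -/
def q (x t : ℝ) : ℝ := d.ω * d.P (d.Y x t) t ^ 2

theorem q_pos (x t : ℝ) : 0 < d.q x t := mul_pos d.ω_pos (pow_pos (d.P_pos _ _) 2)

theorem smooth_q : Smooth d.q := by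
  unfold q
  simp only [sq]
  exact (Smooth.const _).mul ((d.smooth_comp_Y d.smooth_P).mul (d.smooth_comp_Y d.smooth_P))

/-- Since `g_ξ = 1/(ξP)`, the definition of `p` gives `p = ωP/ξ = g_ξ · ωP²`. So `p dξ` is the
pullback of `(m + ω) dx` under `x = g`. -/
theorem abs_deriv_smul_eq {ξ : ℝ} (hξ : ξ ∈ Ioi (0 : ℝ)) (f : ℝ → ℝ) (t : ℝ) :
    |ξ⁻¹ * (d.P (Real.log ξ) t)⁻¹| • (f (g d.ω d.κ d.c₀ ξ t) * d.q (g d.ω d.κ d.c₀ ξ t) t)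
      = f (g d.ω d.κ d.c₀ ξ t) * p d.ω d.κ d.c₀ ξ t := by
  have hpos : 0 < ξ⁻¹ * (d.P (Real.log ξ) t)⁻¹ :=
    mul_pos (inv_pos.2 hξ) (inv_pos.2 (d.P_pos _ _))
  rw [abs_of_pos hpos, d.p_eq hξ, smul_eq_mul]
  nth_rewrite 2 [d.g_eq hξ]
  rw [q, d.Y_gt]
  ring

theorem integrableOn_comp_g_iff (f : ℝ → ℝ) (t : ℝ) :
    IntegrableOn (fun ξ => f (g d.ω d.κ d.c₀ ξ t) * p d.ω d.κ d.c₀ ξ t) (Ioi 0)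
      ↔ Integrable (fun x => f x * d.q x t) := by
  have h := integrableOn_image_iff_integrableOn_abs_deriv_smul measurableSet_Ioi
    (fun ξ hξ => (d.hasDerivAt_g hξ t).hasDerivWithinAt) (d.bijOn_g t).injOn
    (fun x => f x * d.q x t)
  rw [(d.bijOn_g t).image_eq, integrableOn_univ] at h
  rw [h]
  exact integrableOn_congr_fun (fun ξ hξ => (d.abs_deriv_smul_eq hξ f t).symm) measurableSet_Ioi

theorem integral_comp_g (f : ℝ → ℝ) (t : ℝ) :
    ∫ ξ in Ioi (0 : ℝ), f (g d.ω d.κ d.c₀ ξ t) * p d.ω d.κ d.c₀ ξ t = ∫ x, f x * d.q x t := by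
  have h := integral_image_eq_integral_abs_deriv_smul measurableSet_Ioi
    (fun ξ hξ => (d.hasDerivAt_g hξ t).hasDerivWithinAt) (d.bijOn_g t).injOn
    (fun x => f x * d.q x t)
  rw [(d.bijOn_g t).image_eq, setIntegral_univ] at h
  rw [h]
  exact setIntegral_congr_fun measurableSet_Ioi fun ξ hξ => (d.abs_deriv_smul_eq hξ f t).symm

theorem integral_exp_mul_q (x t : ℝ) :
    Integrable (fun z => Real.exp (-|x - z|) * d.q z t) ∧
      ∫ z, Real.exp (-|x - z|) * d.q z t = 2 * (d.sol x t + d.ω) := by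
  obtain ⟨B0, h0⟩ := (d.dec_U t 0).bound
  obtain ⟨B1, h1⟩ := ((d.dec_wplus_R t 0).mono d.wplus_le_one
    fun _ => (Real.exp_pos _).le).bound
  obtain ⟨B2, h2⟩ := (d.dec_P t 0).bound
  simp only [mul_one] at h0 h1 h2
  have hq : ∀ z, (d.sol z t + d.ω) - dx (dx d.sol) z t = d.q z t := fun z => by
    have := congrFun (congrFun d.momentum_sol z) t
    rw [momentum] at this
    rw [q]; linarith
  have hB0 := (abs_nonneg _).trans (h0 0)
  have hB1 := (abs_nonneg _).trans (h1 0)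
  have hω := d.ω_pos
  have hB2 : 0 ≤ d.ω * B2 ^ 2 := by positivity
  have key := integral_green (F := fun z => d.sol z t + d.ω) (F' := fun z => dx d.sol z t)
    (F'' := fun z => dx (dx d.sol) z t) (B := B0 + d.ω + B1 + d.ω * B2 ^ 2)
    (fun z => (d.smooth_sol.hasDerivAt_dx z t).add_const d.ω)
    (fun z => d.smooth_sol.dx.hasDerivAt_dx z t)
    (by simp only [hq]; exact d.smooth_q.continuous_left t)
    (fun z => ?_) (fun z => ?_) (fun z => ?_) x
  · simpa only [hq] using key
  · have := abs_add_le (d.sol z t) d.ω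
    rw [abs_of_pos hω] at this
    linarith [h0 (d.Y z t), show |d.sol z t| ≤ B0 from h0 _]
  · rw [d.dx_sol, abs_neg]
    linarith [h1 (d.Y z t)]
  · rw [hq, abs_of_pos (d.q_pos z t), q]
    have h3 := (le_abs_self _).trans (h2 (d.Y z t))
    have h4 : d.P (d.Y z t) t ^ 2 ≤ B2 ^ 2 := pow_le_pow_left₀ (d.P_pos _ _).le h3 2
    have := mul_le_mul_of_nonneg_left h4 hω.le
    linarith

theorem u_eq : u d.ω d.κ d.c₀ = d.sol := by
  funext x t
  rw [u, d.integral_comp_g (fun z => Real.exp (-|x - z|)) t, (d.integral_exp_mul_q x t).2]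
  ring

theorem momentum_u_add (x t : ℝ) : momentum (u d.ω d.κ d.c₀) x t + d.ω = d.q x t := by
  rw [d.u_eq, d.momentum_sol, q]; ring

theorem isDeltaSuperposition (t : ℝ) : IsDeltaSuperposition
    (fun x => momentum (u d.ω d.κ d.c₀) x t + d.ω)
    (fun ξ => g d.ω d.κ d.c₀ ξ t) (fun ξ => p d.ω d.κ d.c₀ ξ t) := by
  intro θ hθ hsupp
  simp only [d.momentum_u_add]
  have hi : Integrable (fun x => θ x * d.q x t) :=
    (hθ.continuous.mul (d.smooth_q.continuous_left t)).integrable_of_hasCompactSupport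
      hsupp.mul_right
  refine ⟨by simpa only [mul_comm] using hi, (d.integrableOn_comp_g_iff θ t).2 hi, ?_⟩
  rw [d.integral_comp_g θ t]
  simp only [mul_comm]

/-! ### Decay of the momentum -/

theorem exists_abs_Y_sub_le (t : ℝ) : ∃ B : ℝ, ∀ x, |d.Y x t - x| ≤ B := by
  obtain ⟨B, hB⟩ := d.exists_abs_gt_sub_le t
  refine ⟨B, fun x => ?_⟩
  have := hB (d.Y x t)
  rwa [d.gt_Y, abs_sub_comm] at this

/-- `P² - 1 = (P + 1)(P - 1)` decays exponentially in `y` with all derivatives. The bounds pass to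
`x` because `Y_x = P(Y)`, with `P` bounded together with all its derivatives, and because `Y - x` is
bounded. -/
theorem exists_schwartz (t : ℝ) :
    ∃ f : SchwartzMap ℝ ℝ, ∀ x, f x = momentum (u d.ω d.κ d.c₀) x t := by
  have hm : (fun x => momentum (u d.ω d.κ d.c₀) x t)
      = fun x => d.ω * (d.P (d.Y x t) t ^ 2 - 1) := by
    rw [d.u_eq, d.momentum_sol]
  have hsm : ContDiff ℝ (⊤ : ℕ∞) (fun x => d.ω * (d.P (d.Y x t) t ^ 2 - 1)) := by
    have := (d.smooth_q.sub (Smooth.const d.ω)).contDiff_left t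
    convert! this using 2 with x
    rw [q]; ring
  have hdec : ∀ j, Dec (fun x => d.wabs (d.Y x t)) j
      (fun x => d.ω * (d.P (d.Y x t) t ^ 2 - 1)) := fun j => by
    have h1 : Dec d.wabs j (fun y => d.ω * (d.P y t ^ 2 - 1)) := by
      have := (((d.dec_P t j).add (Dec.const 1)).one_mul (d.dec_wabs_P_sub_one t j)).const_mul d.ω
      convert! this using 2 with y
      ring
    exact Dec.comp_flow (fun j => d.dec_P t j) (fun x => d.hasDerivAt_Y x t) h1
  obtain ⟨B, hB⟩ := d.exists_abs_Y_sub_le t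
  refine ⟨⟨fun x => d.ω * (d.P (d.Y x t) t ^ 2 - 1), hsm, fun k n => ?_⟩, fun x =>
    (congrFun hm x).symm⟩
  obtain ⟨C, hC⟩ := (hdec n).abs_iteratedDeriv_le
  have hδ := d.δ_pos
  -- The factor `e^{δB}` replaces `|Y|` by `|x|` in the weight; `k!/δ^k` comes from `(δ|x|)^k / k! ≤
  -- e^{δ|x|}`.
  refine ⟨|C| * Real.exp (d.δ * B) * (k.factorial / d.δ ^ k), fun x => ?_⟩
  rw [norm_iteratedFDeriv_eq_norm_iteratedDeriv, Real.norm_eq_abs, Real.norm_eq_abs]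
  have h1 : |iteratedDeriv n (fun x => d.ω * (d.P (d.Y x t) t ^ 2 - 1)) x|
      ≤ |C| * (Real.exp (d.δ * B) * Real.exp (-(d.δ * |x|))) := by
    refine (hC x).trans (mul_le_mul (le_abs_self C) ?_ (Real.exp_pos _).le (abs_nonneg C))
    rw [wabs, ← Real.exp_add]
    refine Real.exp_le_exp.2 ?_
    have h2 := abs_sub_abs_le_abs_sub x (d.Y x t)
    rw [abs_sub_comm] at h2
    nlinarith [hB x]
  have h2 : |x| ^ k ≤ k.factorial / d.δ ^ k * Real.exp (d.δ * |x|) := by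
    have h3 := Real.pow_div_factorial_le_exp (d.δ * |x|) (by positivity) k
    rw [div_le_iff₀ (by positivity), mul_pow] at h3
    rw [div_mul_eq_mul_div, le_div_iff₀ (by positivity)]
    linarith
  calc |x| ^ k * |iteratedDeriv n (fun x => d.ω * (d.P (d.Y x t) t ^ 2 - 1)) x|
      ≤ (k.factorial / d.δ ^ k * Real.exp (d.δ * |x|))
        * (|C| * (Real.exp (d.δ * B) * Real.exp (-(d.δ * |x|)))) :=
        mul_le_mul h2 h1 (abs_nonneg _) (by positivity)
    _ = |C| * Real.exp (d.δ * B) * (k.factorial / d.δ ^ k)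
        * (Real.exp (d.δ * |x|) * Real.exp (-(d.δ * |x|))) := by ring
    _ = _ := by rw [← Real.exp_add, add_neg_cancel, Real.exp_zero, mul_one]

/-! ### The flow -/

theorem contDiffOn_g : ContDiffOn ℝ (⊤ : ℕ∞) (fun q : ℝ × ℝ => g d.ω d.κ d.c₀ q.1 q.2)
    (Ioi 0 ×ˢ univ) := by
  have h : ContDiffOn ℝ (⊤ : ℕ∞) (fun q : ℝ × ℝ => d.gt (Real.log q.1) q.2) (Ioi 0 ×ˢ univ) := by
    refine ContDiff.comp_contDiffOn (g := fun q : ℝ × ℝ => d.gt q.1 q.2)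
      (f := fun q : ℝ × ℝ => (Real.log q.1, q.2)) d.smooth_gt ?_
    exact (contDiffOn_fst.log fun q hq => ne_of_gt hq.1).prodMk contDiffOn_snd
  exact h.congr fun q hq => d.g_eq hq.1 q.2

theorem hasDerivAt_g_t {ξ : ℝ} (hξ : 0 < ξ) (t : ℝ) :
    HasDerivAt (fun s => g d.ω d.κ d.c₀ ξ s)
      (u d.ω d.κ d.c₀ (g d.ω d.κ d.c₀ ξ t) t) t := by
  simp only [d.g_eq hξ, d.u_eq, sol, d.Y_gt]
  exact d.smooth_gt.hasDerivAt_dt _ t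

/-- The flow of `u`. -/
def flow (t : ℝ) : Diffeomorph (modelWithCornersSelf ℝ ℝ) (modelWithCornersSelf ℝ ℝ) ℝ ℝ
    (⊤ : ℕ∞) where
  toFun x := d.gt (d.Y x 0) t
  invFun x := d.gt (d.Y x t) 0
  left_inv x := by simp only [d.Y_gt, d.gt_Y]
  right_inv x := by simp only [d.Y_gt, d.gt_Y]
  contMDiff_toFun := ((d.smooth_gt.contDiff_left t).comp (d.smooth_Y.contDiff_left 0)).contMDiff
  contMDiff_invFun := ((d.smooth_gt.contDiff_left 0).comp (d.smooth_Y.contDiff_left t)).contMDiff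

theorem flow_apply (t x : ℝ) : d.flow t x = d.gt (d.Y x 0) t := rfl

theorem exists_flow :
    ∃ G : ℝ → Diffeomorph (modelWithCornersSelf ℝ ℝ) (modelWithCornersSelf ℝ ℝ) ℝ ℝ (⊤ : ℕ∞),
      ContDiff ℝ (⊤ : ℕ∞) (fun q : ℝ × ℝ => G q.2 q.1) ∧
      (∀ t ξ : ℝ, 0 < ξ → G t (g d.ω d.κ d.c₀ ξ 0) = g d.ω d.κ d.c₀ ξ t) ∧
      (∀ x : ℝ, G 0 x = x) ∧
      ∀ t x : ℝ, HasDerivAt (fun s => G s x) (u d.ω d.κ d.c₀ (G t x) t) t := by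
  refine ⟨d.flow, ?_, fun t ξ hξ => ?_, fun x => d.gt_Y x 0, fun t x => ?_⟩
  · have h1 : Smooth (fun x _ => d.Y x 0) := d.smooth_Y.comp Smooth.fst (Smooth.const 0)
    have h2 : Smooth (fun x t => d.gt (d.Y x 0) t) := d.smooth_gt.comp h1 Smooth.snd
    exact h2
  · rw [d.flow_apply, d.g_eq hξ, d.g_eq hξ, d.Y_gt]
  · simp only [d.flow_apply, d.u_eq, sol, d.Y_gt]
    exact d.smooth_gt.hasDerivAt_dt _ t

/-! ### Asymptotics at the left end -/

theorem exists_cauchy_inverse : ∃ a : Fin N → ℝ, ∀ p, ∑ n, a n / (d.κ p + d.κ n) = 1 := by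
  let L : (Fin N → ℝ) →ₗ[ℝ] (Fin N → ℝ) :=
    { toFun := fun a p => ∑ n, a n / (d.κ p + d.κ n)
      map_add' := fun a b => by
        funext p; simp [add_div, Finset.sum_add_distrib]
      map_smul' := fun r a => by
        funext p; simp [mul_div_assoc, Finset.mul_sum] }
  have hinj : Function.Injective L := by
    refine (injective_iff_map_eq_zero L).2 fun a ha => ?_
    refine cauchy_system_injective d.κ_pos d.κ_inj (e := fun _ => 0) (fun _ => le_rfl) fun p => ?_
    rw [zero_mul, zero_add]
    exact congrFun ha p
  obtain ⟨a, ha⟩ := (LinearMap.injective_iff_surjective.1 hinj) (fun _ => 1)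
  exact ⟨a, fun p => congrFun ha p⟩

/-- The limit of `v` as `y → -∞`. -/
def vinf : Fin N → ℝ := d.exists_cauchy_inverse.choose

theorem sum_vinf (p : Fin N) : ∑ n, d.vinf n / (d.κ p + d.κ n) = 1 :=
  d.exists_cauchy_inverse.choose_spec p

/-- As `y → -∞`, `E⁻¹ → 0` and the system degenerates to `C v = 1`. The error solves the same system
with right-hand side `-E⁻¹ vinf`, so the uniform bound makes it small. -/
theorem tendsto_v_atBot (n : Fin N) (t : ℝ) :
    Tendsto (fun y => d.v n y t) atBot (𝓝 (d.vinf n)) := by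
  obtain ⟨K, hK0, hK⟩ := exists_norm_le_of_cauchy_system d.κ_pos d.κ_inj
  have hE : ∀ p, Tendsto (fun y => (d.E p y t)⁻¹) atBot (𝓝 0) := fun p => by
    refine (d.dec_inv_E p t 0).tendsto_zero (Real.tendsto_exp_atBot.comp ?_)
    exact tendsto_id.const_mul_atBot (mul_pos two_pos (d.κ_pos p))
  have hb : ∀ y, ‖fun p => d.v p y t - d.vinf p‖ ≤ K * ‖fun p => -((d.E p y t)⁻¹ * d.vinf p)‖ :=
    fun y => by
    refine hK (fun p => (d.E p y t)⁻¹) _ _ (fun p => (inv_pos.2 (d.E_pos p y t)).le) fun p => ?_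
    have h1 := d.system_v p y t
    have h2 := d.sum_vinf p
    simp only [sub_div, Finset.sum_sub_distrib]
    linear_combination h1 - h2
  have hlim : Tendsto (fun y => fun p => -((d.E p y t)⁻¹ * d.vinf p)) atBot
      (𝓝 (0 : Fin N → ℝ)) := by
    refine tendsto_pi_nhds.2 fun p => ?_
    simpa using ((hE p).mul_const (d.vinf p)).neg
  have h0 : Tendsto (fun y => fun p => d.v p y t - d.vinf p) atBot (𝓝 (0 : Fin N → ℝ)) :=
    squeeze_zero_norm hb (by simpa using hlim.norm.const_mul K)
  have := (tendsto_pi_nhds.1 h0 n).add_const (d.vinf n)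
  simpa using this

theorem exists_tendsto_gt_sub_atBot (t : ℝ) :
    ∃ ℓ : ℝ, Tendsto (fun y => d.gt y t - y) atBot (𝓝 ℓ) := by
  have h : ∀ l, Tendsto (fun y => d.Phi l y t) atBot (𝓝 (1 - ∑ n, d.vinf n / (l + d.κ n))) :=
    fun l => (tendsto_finsetSum _ fun n _ => (d.tendsto_v_atBot n t).div_const _).const_sub 1
  obtain ⟨c, hc, hp⟩ := d.exists_le_Pp t
  obtain ⟨c', hc', hm⟩ := d.exists_le_Pm t
  have hp' := ge_of_tendsto (h (1 / 2)) (Eventually.of_forall hp)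
  have hm' := ge_of_tendsto (h (-(1 / 2))) (Eventually.of_forall hm)
  refine ⟨_, (((h (-(1 / 2))).log (hc'.trans_le hm').ne').sub
    ((h (1 / 2)).log (hc.trans_le hp').ne')).congr fun y => ?_⟩
  rw [gt, Pm, Pp]; ring

/-- The shift of the Liouville transformation at `-∞`. -/
def shift (t : ℝ) : ℝ := (d.exists_tendsto_gt_sub_atBot t).choose

theorem tendsto_gt_sub_atBot (t : ℝ) : Tendsto (fun y => d.gt y t - y) atBot (𝓝 (d.shift t)) :=
  (d.exists_tendsto_gt_sub_atBot t).choose_spec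

theorem tendsto_gt_sub_atTop (t : ℝ) : Tendsto (fun y => d.gt y t - y) atTop (𝓝 0) := by
  have := ((d.tendsto_Phi_atTop (-(1 / 2)) t).log one_ne_zero).sub
    ((d.tendsto_Phi_atTop (1 / 2) t).log one_ne_zero)
  rw [Real.log_one, sub_zero] at this
  refine this.congr fun y => ?_
  rw [gt, Pm, Pp]; ring

theorem tendsto_Y_atTop (t : ℝ) : Tendsto (fun x => d.Y x t) atTop atTop := by
  obtain ⟨B, hB⟩ := d.exists_abs_Y_sub_le t
  refine tendsto_atTop_mono (fun y => ?_) (tendsto_atTop_add_const_right atTop (-B) tendsto_id)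
  have := (abs_le.1 (hB y)).1
  simp only [id]; linarith

theorem tendsto_Y_atBot (t : ℝ) : Tendsto (fun x => d.Y x t) atBot atBot := by
  obtain ⟨B, hB⟩ := d.exists_abs_Y_sub_le t
  refine tendsto_atBot_mono (fun y => ?_) (tendsto_atBot_add_const_right atBot B tendsto_id)
  have := (abs_le.1 (hB y)).2
  simp only [id]; linarith

theorem tendsto_sub_Y_atTop (t : ℝ) : Tendsto (fun x => x - d.Y x t) atTop (𝓝 0) :=
  ((d.tendsto_gt_sub_atTop t).comp (d.tendsto_Y_atTop t)).congr fun x => by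
    simp only [Function.comp, d.gt_Y]

theorem tendsto_sub_Y_atBot (t : ℝ) : Tendsto (fun x => x - d.Y x t) atBot (𝓝 (d.shift t)) :=
  ((d.tendsto_gt_sub_atBot t).comp (d.tendsto_Y_atBot t)).congr fun x => by
    simp only [Function.comp, d.gt_Y]

/-! ### Solutions of the spectral problem -/

/-- `∏ (l + κ_n)`. -/
def prodC (l : ℂ) : ℂ := ∏ n, (l + d.κ n)

/-- `∏_{j ≠ n} (l + κ_j)`. -/
def prodErase (n : Fin N) (l : ℂ) : ℂ := ∏ j ∈ Finset.univ.erase n, (l + d.κ j)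

/-- `∏ (l - κ_n)`. -/
def prodNeg (l : ℂ) : ℂ := ∏ n, (l - d.κ n)

theorem mul_prodErase (n : Fin N) (l : ℂ) : (l + d.κ n) * d.prodErase n l = d.prodC l :=
  Finset.mul_prod_erase _ (fun j => l + (d.κ j : ℂ)) (Finset.mem_univ n)

/-- The Baker–Akhiezer function multiplied by `∏ (l + κ_n)`, without its exponential factor. -/
def PhiC (l : ℂ) (t y : ℝ) : ℂ := d.prodC l - ∑ n, (d.v n y t : ℂ) * d.prodErase n l

/-- The derivative of `PhiC`. -/
def PhiC' (l : ℂ) (t y : ℝ) : ℂ := -∑ n, (dx (d.v n) y t : ℂ) * d.prodErase n l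

theorem hasDerivAt_PhiC (l : ℂ) (t y : ℝ) : HasDerivAt (d.PhiC l t) (d.PhiC' l t y) y := by
  have h := (HasDerivAt.sum fun n (_ : n ∈ Finset.univ) =>
    (((d.smooth_v n).hasDerivAt_dx y t).ofReal_comp.mul_const (d.prodErase n l))).const_sub
      (d.prodC l)
  convert! h using 1
  funext z
  simp [PhiC]

/-- The computation of `dx_dx_Phi` with denominators cleared, so that `l = -κ_n`, the bound-state
value, is admissible. -/
theorem hasDerivAt_PhiC' (l : ℂ) (t y : ℝ) :
    HasDerivAt (d.PhiC' l t) (2 * l * d.PhiC' l t y + d.Q y t * d.PhiC l t y) y := by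
  have h := (HasDerivAt.sum fun n (_ : n ∈ Finset.univ) =>
    (((d.smooth_v n).dx.hasDerivAt_dx y t).ofReal_comp.mul_const (d.prodErase n l))).neg
  convert! h using 1
  · funext z
    simp [PhiC']
  · have hs : ∑ n, (dx (dx (d.v n)) y t : ℂ) * d.prodErase n l
        = d.Q y t * ∑ n, (d.v n y t : ℂ) * d.prodErase n l
          + 2 * l * ∑ n, (dx (d.v n) y t : ℂ) * d.prodErase n l - d.Q y t * d.prodC l := by
      have hQ : (d.Q y t : ℂ) * d.prodC l = ∑ n, 2 * (dx (d.v n) y t : ℂ) * d.prodC l := by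
        rw [Q]; push_cast
        rw [← Finset.sum_mul, Finset.mul_sum]
      rw [hQ, Finset.mul_sum, Finset.mul_sum, ← Finset.sum_add_distrib, ← Finset.sum_sub_distrib]
      refine Finset.sum_congr rfl fun n _ => ?_
      rw [d.dx_dx_v, ← d.mul_prodErase n l]
      push_cast
      ring
    rw [hs, PhiC, PhiC']
    ring

/-- The factor `P^{-1/2}`. -/
def amp (t y : ℝ) : ℝ := Real.exp (-(1 / 2) * Real.log (d.P y t))

theorem hasDerivAt_amp (t y : ℝ) :
    HasDerivAt (d.amp t) (d.amp t y * (-(1 / 2) * (dx d.P y t / d.P y t))) y :=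
  (((d.smooth_P.hasDerivAt_dx y t).log (d.P_pos y t).ne').const_mul (-(1 / 2))).exp

/-- A solution of the spectral problem with parameter `l = i k`. -/
def wave (l : ℂ) (t x : ℝ) : ℂ :=
  d.amp t (d.Y x t) * Complex.exp (-l * d.Y x t) * d.PhiC l t (d.Y x t)

/-- The derivative of `wave`. -/
def wave' (l : ℂ) (t x : ℝ) : ℂ :=
  d.amp t (d.Y x t) * Complex.exp (-l * d.Y x t) * (d.P (d.Y x t) t * (d.PhiC' l t (d.Y x t)
    - l * d.PhiC l t (d.Y x t)) - 1 / 2 * dx d.P (d.Y x t) t * d.PhiC l t (d.Y x t))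

theorem hasDerivAt_exp_neg_mul (l : ℂ) (y : ℝ) :
    HasDerivAt (fun y : ℝ => Complex.exp (-l * y)) (Complex.exp (-l * y) * -l) y := by
  have := (((hasDerivAt_id y).ofReal_comp).const_mul (-l)).cexp
  simpa using this

theorem hasDerivAt_wave (l : ℂ) (t x : ℝ) : HasDerivAt (d.wave l t) (d.wave' l t x) x := by
  have h0 : (d.P (d.Y x t) t : ℂ) ≠ 0 := Complex.ofReal_ne_zero.2 (d.P_pos _ _).ne'
  have h := (((d.hasDerivAt_amp t (d.Y x t)).ofReal_comp.mul
    (hasDerivAt_exp_neg_mul l (d.Y x t))).mul (d.hasDerivAt_PhiC l t (d.Y x t))).scomp x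
      (d.hasDerivAt_Y x t)
  convert! h using 1
  rw [wave', Complex.real_smul]
  push_cast
  simp only [Pi.mul_apply]
  field_simp
  ring

/-- Liouville's transformation with `dx = dy/P` and amplitude `P^{-1/2}`: first-order terms cancel,
and `four_P_sq_Q` turns `Q + l²` into the weighted potential. -/
theorem hasDerivAt_wave' (l : ℂ) (t x : ℝ) : HasDerivAt (d.wave' l t)
    ((1 / 4 + (l ^ 2 - 1 / 4) * d.P (d.Y x t) t ^ 2) * d.wave l t x) x := by
  have h0 : (d.P (d.Y x t) t : ℂ) ≠ 0 := Complex.ofReal_ne_zero.2 (d.P_pos _ _).ne'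
  set y := d.Y x t with hy
  have hP := (d.smooth_P.hasDerivAt_dx y t).ofReal_comp
  have hP' := (d.smooth_P.dx.hasDerivAt_dx y t).ofReal_comp
  have hF := d.hasDerivAt_PhiC l t y
  have hF' := d.hasDerivAt_PhiC' l t y
  have h := ((((d.hasDerivAt_amp t y).ofReal_comp.mul (hasDerivAt_exp_neg_mul l y)).mul
    ((hP.mul (hF'.sub (hF.const_mul l))).sub ((hP'.const_mul (1 / 2)).mul hF)))).scomp x
      (d.hasDerivAt_Y x t)
  convert! h using 1
  have h4 : (4 * d.P y t ^ 2 * d.Q y t : ℂ)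
    = 2 * d.P y t * dx (dx d.P) y t - dx d.P y t ^ 2 + 1 - d.P y t ^ 2 := by
    exact_mod_cast congrArg (fun r : ℝ => (r : ℂ)) (d.four_P_sq_Q y t)
  rw [wave, Complex.real_smul, ← hy]
  push_cast
  simp only [Pi.mul_apply, Pi.sub_apply]
  field_simp
  linear_combination (-4 * (d.amp t y : ℂ) * d.PhiC l t y) * h4

theorem contDiff_wave (l : ℂ) (t : ℝ) : ContDiff ℝ 2 (d.wave l t) := by
  have h1 : deriv (d.wave l t) = d.wave' l t := funext fun x => (d.hasDerivAt_wave l t x).deriv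
  have h2 : deriv (d.wave' l t) = fun x =>
      (1 / 4 + (l ^ 2 - 1 / 4) * d.P (d.Y x t) t ^ 2) * d.wave l t x :=
    funext fun x => (d.hasDerivAt_wave' l t x).deriv
  have hd : Differentiable ℝ (d.wave l t) := fun x => (d.hasDerivAt_wave l t x).differentiableAt
  have hd' : Differentiable ℝ (d.wave' l t) := fun x =>
    (d.hasDerivAt_wave' l t x).differentiableAt
  rw [show (2 : WithTop ℕ∞) = 1 + 1 by norm_num, contDiff_succ_iff_deriv]
  refine ⟨hd, by simp, ?_⟩
  rw [h1, contDiff_one_iff_deriv, h2]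
  refine ⟨hd', (continuous_const.add (continuous_const.mul (Continuous.pow ?_ 2))).mul
    hd.continuous⟩
  exact Complex.continuous_ofReal.comp ((d.smooth_comp_Y d.smooth_P).continuous_left t)

theorem solvesSpectral (k K : ℂ) (t : ℝ) :
    SolvesSpectral d.ω (fun x => momentum (u d.ω d.κ d.c₀) x t) k
      (fun x => K * d.wave (Complex.I * k) t x) := by
  refine ⟨contDiff_const.mul (d.contDiff_wave _ t), fun x => ?_⟩
  have h1 : deriv (fun x => K * d.wave (Complex.I * k) t x)
      = fun x => K * d.wave' (Complex.I * k) t x :=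
    funext fun x => ((d.hasDerivAt_wave _ t x).const_mul K).deriv
  rw [h1, ((d.hasDerivAt_wave' _ t x).const_mul K).deriv]
  have hm : ((momentum (u d.ω d.κ d.c₀) x t : ℂ) + (d.ω : ℂ))
      = d.ω * (d.P (d.Y x t) t : ℂ) ^ 2 := by
    rw [← Complex.ofReal_add, d.momentum_u_add, q]
    push_cast; ring
  have hω : (d.ω : ℂ) ≠ 0 := Complex.ofReal_ne_zero.2 d.ω_pos.ne'
  rw [hm, spectralParam, mul_pow, Complex.I_sq]
  field_simp
  ring

/-! ### Asymptotics of the solutions -/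

theorem tendsto_amp {l : Filter ℝ} {t : ℝ} (h : Tendsto (fun y => d.P y t) l (𝓝 1)) :
    Tendsto (d.amp t) l (𝓝 1) := by
  have := ((h.log one_ne_zero).const_mul (-(1 / 2))).rexp
  rw [Real.log_one, mul_zero, Real.exp_zero] at this
  exact this

theorem wave_mul_exp (l : ℂ) (t x : ℝ) : d.wave l t x * Complex.exp (l * x)
    = d.amp t (d.Y x t) * Complex.exp (l * (x - d.Y x t : ℝ)) * d.PhiC l t (d.Y x t) := by
  rw [wave, show l * ((x - d.Y x t : ℝ) : ℂ) = -l * d.Y x t + l * x by push_cast; ring,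
    Complex.exp_add]
  ring

theorem tendsto_wave_atTop (l : ℂ) (t : ℝ) :
    Tendsto (fun x : ℝ => d.wave l t x * Complex.exp (l * x)) atTop (𝓝 (d.prodC l)) := by
  simp only [d.wave_mul_exp]
  have h1 : Tendsto (fun x => (d.amp t (d.Y x t) : ℂ)) atTop (𝓝 ((1 : ℝ) : ℂ)) :=
    ((d.tendsto_amp (d.tendsto_P_atTop t)).comp (d.tendsto_Y_atTop t)).ofReal
  have h2 : Tendsto (fun x => Complex.exp (l * (x - d.Y x t : ℝ))) atTop (𝓝 1) := by
    have := ((d.tendsto_sub_Y_atTop t).ofReal.const_mul l).cexp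
    simpa only [Complex.ofReal_zero, mul_zero, Complex.exp_zero] using this
  have h3 : Tendsto (d.PhiC l t) atTop (𝓝 (d.prodC l)) := by
    have : Tendsto (fun y => ∑ n, (d.v n y t : ℂ) * d.prodErase n l) atTop
        (𝓝 (∑ n, ((0 : ℝ) : ℂ) * d.prodErase n l)) :=
      tendsto_finsetSum _ fun n _ => ((d.dec_wplus_v n t 0).tendsto_zero
        d.tendsto_wplus).ofReal.mul_const _
    have := this.const_sub (d.prodC l)
    simp only [Complex.ofReal_zero, zero_mul, Finset.sum_const_zero, sub_zero] at this
    exact this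
  have := (h1.mul h2).mul (h3.comp (d.tendsto_Y_atTop t))
  simpa using this

-- Both sides are monic polynomials of degree `N` in `l`. The left one vanishes at every `κ_p`,
-- because there `∑ vinf_n/(κ_p + κ_n) = 1`, so it is `∏(l - κ_n)`.
open Polynomial in
theorem prodC_sub_sum_vinf (l : ℂ) :
    d.prodC l - ∑ n, (d.vinf n : ℂ) * d.prodErase n l = d.prodNeg l := by
  set f : ℂ[X] := ∏ n, (X + C (d.κ n : ℂ))
    - ∑ n, C (d.vinf n : ℂ) * ∏ j ∈ Finset.univ.erase n, (X + C (d.κ j : ℂ)) with hf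
  set h : ℂ[X] := ∏ n, (X - C (d.κ n : ℂ)) with hh
  have hm1 : ∀ s : Finset (Fin N), (∏ n ∈ s, (X + C (d.κ n : ℂ))).Monic := fun s =>
    monic_prod_of_monic _ _ fun n _ => monic_X_add_C _
  have hm2 : (∏ n, (X - C (d.κ n : ℂ))).Monic := monic_prod_of_monic _ _ fun n _ => monic_X_sub_C _
  have hd1 : ∀ s : Finset (Fin N), (∏ n ∈ s, (X + C (d.κ n : ℂ))).degree = (s.card : WithBot ℕ) := fun s => by
    rw [degree_prod]; simp
  have hd2 : (∏ n, (X - C (d.κ n : ℂ))).degree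
      = ((Finset.univ : Finset (Fin N)).card : WithBot ℕ) := by
    rw [degree_prod]; simp
  have hdeg : (f - h).degree < (Finset.univ : Finset (Fin N)).card := by
    have e : f - h = (∏ n, (X + C (d.κ n : ℂ)) - ∏ n, (X - C (d.κ n : ℂ)))
        - ∑ n, C (d.vinf n : ℂ) * ∏ j ∈ Finset.univ.erase n, (X + C (d.κ j : ℂ)) := by
      rw [hf, hh]; ring
    rw [e, ← mem_degreeLT]
    refine Submodule.sub_mem _ ?_ (Submodule.sum_mem _ fun n _ => ?_)
    · rw [mem_degreeLT, ← hd1 Finset.univ]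
      refine degree_sub_lt_left ((hd1 _).trans hd2.symm) (hm1 _).ne_zero ?_
      rw [(hm1 _).leadingCoeff, hm2.leadingCoeff]
    · rw [mem_degreeLT]
      rw [C_mul']
      refine (degree_smul_le _ _).trans_lt ?_
      rw [hd1]
      exact_mod_cast Finset.card_erase_lt_of_mem (Finset.mem_univ n)
  have hinj : Set.InjOn (fun n => (d.κ n : ℂ)) (Finset.univ : Finset (Fin N)) :=
    fun a _ b _ hab => d.κ_inj (Complex.ofReal_injective hab)
  have hfh : f = h := by
    refine eq_of_degree_sub_lt_of_eval_index_eq _ hinj hdeg fun p _ => ?_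
    have hr : h.eval (d.κ p : ℂ) = 0 := by
      rw [hh, eval_prod]
      exact Finset.prod_eq_zero (Finset.mem_univ p) (by simp)
    have hl : f.eval (d.κ p : ℂ) = d.prodC (d.κ p)
        - ∑ n, (d.vinf n : ℂ) * d.prodErase n (d.κ p) := by
      simp [hf, prodC, prodErase, eval_prod, eval_finsetSum]
    rw [hr, hl]
    have e1 : ∑ n, (d.vinf n : ℂ) * d.prodErase n (d.κ p)
        = ((∑ n, d.vinf n / (d.κ p + d.κ n) : ℝ) : ℂ) * d.prodC (d.κ p) := by
      push_cast
      rw [Finset.sum_mul]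
      refine Finset.sum_congr rfl fun n _ => ?_
      rw [← d.mul_prodErase n]
      have : (d.κ p + d.κ n : ℂ) ≠ 0 := by exact_mod_cast (d.κ_add_pos p n).ne'
      field_simp
    rw [e1, d.sum_vinf]
    simp
  have := congrArg (eval l) hfh
  simpa [hf, hh, prodC, prodErase, prodNeg, eval_prod, eval_finsetSum] using this

theorem tendsto_wave_atBot (l : ℂ) (t : ℝ) :
    Tendsto (fun x : ℝ => d.wave l t x * Complex.exp (l * x)) atBot
      (𝓝 (Complex.exp (l * d.shift t) * d.prodNeg l)) := by
  simp only [d.wave_mul_exp]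
  have h1 : Tendsto (fun x => (d.amp t (d.Y x t) : ℂ)) atBot (𝓝 ((1 : ℝ) : ℂ)) :=
    ((d.tendsto_amp (d.tendsto_P_atBot t)).comp (d.tendsto_Y_atBot t)).ofReal
  have h2 : Tendsto (fun x => Complex.exp (l * (x - d.Y x t : ℝ))) atBot
      (𝓝 (Complex.exp (l * d.shift t))) :=
    ((d.tendsto_sub_Y_atBot t).ofReal.const_mul l).cexp
  have h3 : Tendsto (d.PhiC l t) atBot (𝓝 (d.prodNeg l)) := by
    rw [← d.prodC_sub_sum_vinf]
    exact (tendsto_finsetSum _ fun n _ =>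
      (d.tendsto_v_atBot n t).ofReal.mul_const _).const_sub (d.prodC l)
  have := (h1.mul h2).mul (h3.comp (d.tendsto_Y_atBot t))
  simpa using this

/-! ### Scattering data -/

/-- The value at `x = -∞` of `wave (i k) e^{ikx}`. -/
def leftNorm (t : ℝ) (k : ℂ) : ℂ :=
  Complex.exp (Complex.I * k * d.shift t) * d.prodNeg (Complex.I * k)

/-- The transmission coefficient `a(k)`. -/
def coefA (t : ℝ) (k : ℂ) : ℂ := d.prodC (Complex.I * k) / d.leftNorm t k

/-- The Jost solution normalized at `-∞`. -/
def jost (t : ℝ) (k : ℂ) (x : ℝ) : ℂ := (d.leftNorm t k)⁻¹ * d.wave (Complex.I * k) t x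

theorem prodNeg_ne_zero {k : ℂ} (hk : 0 ≤ k.im) : d.prodNeg (Complex.I * k) ≠ 0 := by
  refine Finset.prod_ne_zero_iff.2 fun n _ h => ?_
  have := congrArg Complex.re h
  simp at this
  linarith [d.κ_pos n]

theorem leftNorm_ne_zero (t : ℝ) {k : ℂ} (hk : 0 ≤ k.im) : d.leftNorm t k ≠ 0 :=
  mul_ne_zero (Complex.exp_ne_zero _) (d.prodNeg_ne_zero hk)

theorem isJostLeft_jost (t : ℝ) {k : ℂ} (hk : 0 ≤ k.im) :
    IsJostLeft d.ω (fun x => momentum (u d.ω d.κ d.c₀) x t) k (d.jost t k) := by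
  refine ⟨d.solvesSpectral k _ t, ?_⟩
  have := (d.tendsto_wave_atBot (Complex.I * k) t).const_mul (d.leftNorm t k)⁻¹
  rw [← leftNorm, inv_mul_cancel₀ (d.leftNorm_ne_zero t hk)] at this
  simpa only [jost, mul_assoc] using this

theorem tendsto_jost_atTop (t : ℝ) (k : ℂ) :
    Tendsto (fun x : ℝ => d.jost t k x * Complex.exp (Complex.I * k * x)) atTop
      (𝓝 (d.coefA t k)) := by
  have := (d.tendsto_wave_atTop (Complex.I * k) t).const_mul (d.leftNorm t k)⁻¹
  rw [inv_mul_eq_div, ← coefA] at this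
  simpa only [jost, mul_assoc] using this

theorem prodC_ne_zero (k : ℝ) : d.prodC (Complex.I * k) ≠ 0 := by
  refine Finset.prod_ne_zero_iff.2 fun n _ h => ?_
  have := congrArg Complex.re h
  simp at this
  linarith [d.κ_pos n]

/-- Both Jost solutions are multiples of the same function `wave`, so there is no reflected
component. For real `k` the modulus of `e^{ikx}` is 1, which converts the multiplicative asymptotics
into the additive ones required at `+∞`. -/
theorem isTransition (t k : ℝ) : IsTransition d.ω
    (fun x => momentum (u d.ω d.κ d.c₀) x t) k (d.coefA t k) 0 := by
  have h0 := d.prodC_ne_zero k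
  refine ⟨d.jost t k, fun x => (d.prodC (Complex.I * k))⁻¹ * d.wave (Complex.I * k) t x,
    d.isJostLeft_jost t (by simp), ⟨d.solvesSpectral k _ t, ?_⟩, fun x => ?_⟩
  · have h1 := (d.tendsto_wave_atTop (Complex.I * k) t).const_mul (d.prodC (Complex.I * k))⁻¹
    rw [inv_mul_cancel₀ h0] at h1
    have h2 := (h1.sub_const 1).norm
    rw [sub_self, norm_zero] at h2
    refine squeeze_zero_norm (fun x => le_of_eq ?_) h2
    have h3 : ‖Complex.exp (Complex.I * k * x)‖ = 1 := by
      rw [show Complex.I * k * x = ((k * x : ℝ) : ℂ) * Complex.I by push_cast; ring]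
      exact Complex.norm_exp_ofReal_mul_I _
    rw [← mul_one ‖_ * _ - Complex.exp _‖, ← h3, ← norm_mul, sub_mul, ← Complex.exp_add]
    congr 1
    rw [show -Complex.I * k * x + Complex.I * k * x = 0 by ring, Complex.exp_zero, mul_assoc]
  · rw [jost, coefA, zero_mul, add_zero]
    field_simp

/-- For real `k`, `ik - κ_n` is minus the complex conjugate of `ik + κ_n`, and the shift only
contributes a phase. -/
theorem norm_coefA (t k : ℝ) : ‖d.coefA t k‖ = 1 := by
  have h1 : ‖Complex.exp (Complex.I * k * d.shift t)‖ = 1 := by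
    rw [show Complex.I * k * d.shift t = ((k * d.shift t : ℝ) : ℂ) * Complex.I by push_cast; ring]
    exact Complex.norm_exp_ofReal_mul_I _
  have h2 : ‖d.prodNeg (Complex.I * k)‖ = ‖d.prodC (Complex.I * k)‖ := by
    rw [prodNeg, prodC, norm_prod, norm_prod]
    refine Finset.prod_congr rfl fun n _ => ?_
    rw [← Complex.norm_conj, ← norm_neg]
    congr 1
    simp
    ring
  rw [coefA, leftNorm, norm_div, norm_mul, h1, h2, one_mul,
    div_self (norm_ne_zero_iff.2 (d.prodC_ne_zero k))]

theorem differentiable_leftNorm (t : ℝ) : Differentiable ℂ (d.leftNorm t) := by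
  unfold leftNorm prodNeg; fun_prop

theorem differentiable_prodErase (n : Fin N) :
    Differentiable ℂ (fun k => d.prodErase n (Complex.I * k)) := by
  unfold prodErase; fun_prop

theorem differentiable_prodC : Differentiable ℂ (fun k => d.prodC (Complex.I * k)) := by
  unfold prodC; fun_prop

theorem differentiableAt_coefA (t : ℝ) {k : ℂ} (hk : 0 ≤ k.im) :
    DifferentiableAt ℂ (d.coefA t) k :=
  (d.differentiable_prodC k).div (d.differentiable_leftNorm t k) (d.leftNorm_ne_zero t hk)

theorem coefA_eq_zero_iff (t : ℝ) {k : ℂ} (hk : 0 < k.im) :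
    d.coefA t k = 0 ↔ ∃ n, k = Complex.I * (d.κ n : ℂ) := by
  rw [coefA, div_eq_zero_iff, or_iff_left (d.leftNorm_ne_zero t hk.le), prodC,
    Finset.prod_eq_zero_iff]
  simp only [Finset.mem_univ, true_and]
  refine exists_congr fun n => ⟨fun h => ?_, fun h => ?_⟩
  · linear_combination (-Complex.I) * h + k * Complex.I_sq
  · rw [h, ← mul_assoc, Complex.I_mul_I]; ring

theorem I_mul_I_mul (n : Fin N) : Complex.I * (Complex.I * (d.κ n : ℂ)) = -d.κ n := by
  rw [← mul_assoc, Complex.I_mul_I]; ring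

theorem im_I_mul_pos (n : Fin N) : 0 < (Complex.I * (d.κ n : ℂ)).im := by
  simpa using d.κ_pos n

theorem prodErase_neg_ne_zero (n : Fin N) : d.prodErase n (-d.κ n) ≠ 0 := by
  refine Finset.prod_ne_zero_iff.2 fun j hj h => ?_
  refine Finset.ne_of_mem_erase hj (d.κ_inj (Complex.ofReal_injective ?_))
  linear_combination h

/-- Splitting off the linear factor `ik + κ_n` that vanishes at `iκ_n`, the derivative there is `i`
times the remaining factor. -/
theorem deriv_coefA (t : ℝ) (n : Fin N) : deriv (d.coefA t) (Complex.I * (d.κ n : ℂ))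
    = Complex.I * (d.prodErase n (-d.κ n) / d.leftNorm t (Complex.I * d.κ n)) := by
  set k₀ := Complex.I * (d.κ n : ℂ) with hk₀
  have hH : DifferentiableAt ℂ
      (fun k => d.prodErase n (Complex.I * k) / d.leftNorm t k) k₀ :=
    (d.differentiable_prodErase n k₀).div (d.differentiable_leftNorm t k₀)
      (d.leftNorm_ne_zero t (d.im_I_mul_pos n).le)
  have hl : HasDerivAt (fun k : ℂ => Complex.I * k + d.κ n) Complex.I k₀ := by
    simpa using ((hasDerivAt_id k₀).const_mul Complex.I).add_const (d.κ n : ℂ)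
  have h := hl.mul hH.hasDerivAt
  have he : d.coefA t = fun k => (Complex.I * k + d.κ n) *
      (d.prodErase n (Complex.I * k) / d.leftNorm t k) := by
    funext k
    rw [coefA, ← d.mul_prodErase n, mul_div_assoc]
  rw [he]
  refine h.deriv.trans ?_
  rw [d.I_mul_I_mul n]
  ring

/-- The real numbers `b_n`. -/
def coefB (t : ℝ) (n : Fin N) : ℝ :=
  -(cEvol d.ω d.κ d.c₀ t n * ((∏ j ∈ Finset.univ.erase n, (-d.κ n + d.κ j))
    / (Real.exp (-d.κ n * d.shift t) * ∏ j, (-d.κ n - d.κ j))))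

theorem coefB_eq (t : ℝ) (n : Fin N) : (d.coefB t n : ℂ) = -(cEvol d.ω d.κ d.c₀ t n *
    (d.prodErase n (-d.κ n) / d.leftNorm t (Complex.I * d.κ n))) := by
  rw [coefB, leftNorm, prodErase, prodNeg, d.I_mul_I_mul n]
  push_cast
  rfl

theorem PhiC_neg (n : Fin N) (t y : ℝ) :
    d.PhiC (-d.κ n) t y = -((d.v n y t : ℂ) * d.prodErase n (-d.κ n)) := by
  have h1 : d.prodC (-d.κ n) = 0 :=
    Finset.prod_eq_zero (Finset.mem_univ n) (neg_add_cancel _)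
  have h2 : ∑ j, (d.v j y t : ℂ) * d.prodErase j (-d.κ n)
      = (d.v n y t : ℂ) * d.prodErase n (-d.κ n) := by
    refine Finset.sum_eq_single n (fun j _ hj => ?_) (by simp)
    rw [prodErase, Finset.prod_eq_zero (i := n)
      (Finset.mem_erase.2 ⟨hj.symm, Finset.mem_univ n⟩) (neg_add_cancel _), mul_zero]
  rw [PhiC, h1, h2, zero_sub]

/-- At `l = -κ_n` only the residue term with `v_n = c_n e^{-2κ_n y} w_n` survives. It turns the
growing factor `e^{κ_n y}` into `e^{-κ_n y}`, and `w_n = Φ(κ_n) → 1`, so `c_n` appears as the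
norming constant. -/
theorem tendsto_jost_bound_state (t : ℝ) (n : Fin N) :
    Tendsto (fun x : ℝ => d.jost t (Complex.I * (d.κ n : ℂ)) x * Complex.exp ((d.κ n : ℂ) * x))
      atTop (𝓝 (d.coefB t n : ℂ)) := by
  have hY := d.tendsto_Y_atTop t
  have h1 := (d.tendsto_amp (d.tendsto_P_atTop t)).comp hY
  have h2 := ((d.tendsto_sub_Y_atTop t).const_mul (d.κ n)).rexp
  have h3 : Tendsto (fun y => d.w n y t) atTop (𝓝 1) :=
    (d.tendsto_Phi_atTop (d.κ n) t).congr fun y => (d.w_eq n y t).symm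
  have h4 := ((h1.mul h2).mul (h3.comp hY)).ofReal.mul_const
    (-(cEvol d.ω d.κ d.c₀ t n * (d.prodErase n (-d.κ n) / d.leftNorm t (Complex.I * d.κ n))))
  simp only [mul_zero, Real.exp_zero, mul_one, Complex.ofReal_one, one_mul] at h4
  rw [d.coefB_eq]
  refine h4.congr fun x => ?_
  have he : Real.exp (d.κ n * (x - d.Y x t))
      = Real.exp (d.κ n * d.Y x t) * Real.exp (-2 * d.κ n * d.Y x t) * Real.exp (d.κ n * x) := by
    rw [← Real.exp_add, ← Real.exp_add]; congr 1; ring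
  rw [jost, wave, d.I_mul_I_mul n, d.PhiC_neg, neg_neg, v, E, he]
  simp only [Function.comp]
  push_cast
  ring

theorem isReflectionlessWithData (t : ℝ) : IsReflectionlessWithData d.ω
    (fun x => momentum (u d.ω d.κ d.c₀) x t) d.κ (cEvol d.ω d.κ d.c₀ t) := by
  refine ⟨d.coefA t, d.coefB t, fun k _ => ⟨d.isTransition t k, d.norm_coefA t k⟩,
    fun k hk => (d.differentiableAt_coefA t hk).continuousAt.continuousWithinAt,
    fun k hk => (d.differentiableAt_coefA t (le_of_lt hk)).differentiableWithinAt,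
    fun k hk => ⟨d.jost t k, d.isJostLeft_jost t hk.le, d.tendsto_jost_atTop t k⟩,
    fun k hk => d.coefA_eq_zero_iff t hk, fun n => ?_⟩
  have hH : d.prodErase n (-d.κ n) / d.leftNorm t (Complex.I * d.κ n) ≠ 0 :=
    div_ne_zero (d.prodErase_neg_ne_zero n) (d.leftNorm_ne_zero t (d.im_I_mul_pos n).le)
  refine ⟨?_, ?_, d.jost t (Complex.I * d.κ n), d.isJostLeft_jost t (d.im_I_mul_pos n).le,
    d.tendsto_jost_bound_state t n⟩
  · rw [d.deriv_coefA]
    exact mul_ne_zero Complex.I_ne_zero hH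
  · rw [d.deriv_coefA, d.coefB_eq, ← mul_assoc, Complex.I_mul_I]
    generalize d.prodErase n (-d.κ n) / d.leftNorm t (Complex.I * d.κ n) = z at hH
    field_simp

end SolitonData

end CamassaHolm

end

/-! ### Assembly of the conclusions -/

theorem mainTheorem3 {N : ℕ} (ω : ℝ) (hω : 0 < ω) (κ c₀ : Fin N → ℝ)
    (hκ_mono : StrictMono κ) (hκ_pos : ∀ n, 0 < κ n) (hκ_lt : ∀ n, κ n < 1 / 2)
    (hc₀ : ∀ n, 0 < c₀ n) :
    -- the explicit formulas make sense
    CamassaHolm.FormulasWellDefined ω κ c₀ ∧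
    (∀ x t : ℝ, IntegrableOn
      (fun ξ => Real.exp (-|x - CamassaHolm.g ω κ c₀ ξ t|) * CamassaHolm.p ω κ c₀ ξ t)
      (Ioi 0)) ∧
    -- `u` is the `N`-soliton solution: a smooth solution with Schwartz momentum, `m + ω > 0`,
    -- reflectionless, with scattering data `κ_n`, `c_n(t)`
    CamassaHolm.IsSmoothSolution ω (CamassaHolm.u ω κ c₀) ∧
    (∀ t : ℝ, ∃ f : SchwartzMap ℝ ℝ,
      ∀ x, f x = CamassaHolm.momentum (CamassaHolm.u ω κ c₀) x t) ∧
    (∀ x t : ℝ, 0 < CamassaHolm.momentum (CamassaHolm.u ω κ c₀) x t + ω) ∧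
    (∀ t : ℝ, CamassaHolm.IsReflectionlessWithData ω
      (fun x => CamassaHolm.momentum (CamassaHolm.u ω κ c₀) x t) κ
      (CamassaHolm.cEvol ω κ c₀ t)) ∧
    -- `g(·,t)` is a smooth diffeomorphism of `(0,∞)` onto the line, smooth in `(ξ,t)`
    ContDiffOn ℝ (⊤ : ℕ∞) (fun q : ℝ × ℝ => CamassaHolm.g ω κ c₀ q.1 q.2)
      (Ioi 0 ×ˢ univ) ∧
    (∀ t : ℝ, BijOn (fun ξ => CamassaHolm.g ω κ c₀ ξ t) (Ioi 0) univ) ∧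
    (∀ t ξ : ℝ, 0 < ξ → 0 < deriv (fun s => CamassaHolm.g ω κ c₀ s t) ξ) ∧
    -- `ġ = u ∘ g`
    (∀ t ξ : ℝ, 0 < ξ →
      HasDerivAt (fun s => CamassaHolm.g ω κ c₀ ξ s)
        (CamassaHolm.u ω κ c₀ (CamassaHolm.g ω κ c₀ ξ t) t) t) ∧
    -- the flow of `u` is the family of diffeomorphisms `g(·,t) ∘ g(·,0)⁻¹` of the line
    (∃ G : ℝ → Diffeomorph (modelWithCornersSelf ℝ ℝ) (modelWithCornersSelf ℝ ℝ) ℝ ℝ (⊤ : ℕ∞),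
      ContDiff ℝ (⊤ : ℕ∞) (fun q : ℝ × ℝ => G q.2 q.1) ∧
      (∀ t ξ : ℝ, 0 < ξ → G t (CamassaHolm.g ω κ c₀ ξ 0) = CamassaHolm.g ω κ c₀ ξ t) ∧
      (∀ x : ℝ, G 0 x = x) ∧
      ∀ t x : ℝ, HasDerivAt (fun s => G s x) (CamassaHolm.u ω κ c₀ (G t x) t) t) ∧
    -- `m = ∫ δ(x - g) p dξ - ω`
    ∀ t : ℝ, CamassaHolm.IsDeltaSuperposition
      (fun x => CamassaHolm.momentum (CamassaHolm.u ω κ c₀) x t + ω)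
      (fun ξ => CamassaHolm.g ω κ c₀ ξ t) (fun ξ => CamassaHolm.p ω κ c₀ ξ t) := by
  let d : CamassaHolm.SolitonData N :=
    ⟨ω, κ, c₀, hω, hκ_mono.injective, hκ_pos, hκ_lt, hc₀⟩
  refine ⟨d.formulasWellDefined, fun x t => ?_, ?_, d.exists_schwartz, fun x t => ?_,
    d.isReflectionlessWithData, d.contDiffOn_g, d.bijOn_g, fun t ξ hξ => ?_,
    fun t ξ hξ => d.hasDerivAt_g_t hξ t, d.exists_flow, d.isDeltaSuperposition⟩
  · exact (d.integrableOn_comp_g_iff (fun z => Real.exp (-|x - z|)) t).2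
      (d.integral_exp_mul_q x t).1
  · have h := d.isSmoothSolution_sol
    rw [← d.u_eq] at h
    exact h
  · have h := d.q_pos x t
    rw [← d.momentum_u_add] at h
    exact h
  · have h : 0 < ξ⁻¹ * (d.P (Real.log ξ) t)⁻¹ :=
      mul_pos (inv_pos.2 hξ) (inv_pos.2 (d.P_pos _ _))
    rw [← (d.hasDerivAt_g hξ t).deriv] at h
    exact h
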